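/- **Theorem 5.8.** *Conventions.* An mm-space $X=(X,d_X,\mu_X)$ is a compact metric space with a finite Borel measure; $B_r(x)$ is the open ball. For $\rho>0$ the $\rho$-Laplacian is the bounded operator on $L^2(X,\mu_X)$ $$\Delta^\rho_Xu(x)=\frac1{\rho^2\mu_X(B_\rho(x))}\int_{B_\rho(x)}\bigl(u(x)-u(y)\bigr)\,d\mu_X(y).$$ It is self-adjoint and non-negative for an equivalent scalar product. Its discrete spectrum consists of the isolated eigenvalues of finite multiplicity, the rest of its spectrum is the essential spectrum, and $\lambda_\infty$ is the infimum of the essential spectrum ($+\infty$ if it is empty). For $k=1,2,\dots$, $\lambda_k(X,\rho)\in[0,+\infty]$ is the $k$-th smallest eigenvalue of $\Delta^\rho_X$, counted with multiplicity, among those smaller than $\lambda_\infty$; if there are fewer than $k$ such eigenvalues, $\lambda_k(X,\rho)=\lambda_\infty$. Let $\varepsilon,\delta\ge0$. The mm-spaces $X,Y$ are $(\varepsilon,\delta)$-close if there is a semi-metric $d$ on $X\sqcup Y$ extending $d_X$ and $d_Y$ such that for every Borel set $A\subset X\sqcup Y$, with $A^\varepsilon=\{z: d(z,A)\le\varepsilon\}$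 and with $\mu_X,\mu_Y$ regarded as measures on $X\sqcup Y$, one has $e^\delta\mu_X(A^\varepsilon)\ge\mu_Y(A)$ and $e^\delta\mu_Y(A^\varepsilon)\ge\mu_X(A)$. For $\eta\ge 0$, $X$ satisfies $SLV(\Lambda,\rho,\eta)$ if for all $x\in\operatorname{supp}\mu_X$ $$\frac{\mu_X(B_{\rho+\eta}(x)\setminus B_\rho(x))}{\mu_X(B_\rho(x))}\le\Lambda\frac{\eta}{\rho},$$ and $BIV(\Lambda,\rho,\eta)$ if $\mu_X(B_\rho(x)\cap B_\rho(y))\ge\Lambda^{-1}\mu_X(B_{\rho+\eta}(x))$ for all $x,y\in\operatorname{supp}\mu_X$ with $d_X(x,y)\le\rho+\eta$. *Statement.* For every $\Lambda>0$ there exists $C=C(\Lambda)>0$ such that the following holds. Let $\rho>0$, $0\le\varepsilon\le\rho/4$, $\delta\ge0$, and let $X,Y$ be $(\varepsilon,\delta)$-close mm-spaces which both satisfy $SLV(\Lambda,\rho,2\varepsilon)$ and $BIV(\Lambda,\rho,2\varepsilon)$. Then for every $k\ge1$ with $\lambda_k(X,\rho)<e^{-4\delta}(1+C\varepsilon/\rho)^{-1}\rho^{-2}$,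 $$e^{-4\delta}(1+C\varepsilon/\rho)^{-1}\le\frac{\lambda_k(X,\rho)}{\lambda_k(Y,\rho)}\le e^{4\delta}(1+C\varepsilon/\rho),$$ where the estimate is understood as $$e^{-4\delta}(1+C\varepsilon/\rho)^{-1}\lambda_k(Y,\rho)\le\lambda_k(X,\rho)\le e^{4\delta}(1+C\varepsilon/\rho)\,\lambda_k(Y,\rho).$$ In particular $\lambda_k(Y,\rho)<\infty$, and $\lambda_k(X,\rho)=0$ if and only if $\lambda_k(Y,\rho)=0$. -/

import Mathlib

universe u v

open MeasureTheory Metric Set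
open scoped ENNReal

namespace MMSpace

noncomputable section

section Laplacian

variable {X : Type*} [PseudoMetricSpace X] [MeasurableSpace X]

/-- The pointwise formula of the `ρ`-Laplacian:
`1 / (ρ² μ(B_ρ(x))) * ∫_{B_ρ(x)} (u(x) - u(y)) dμ(y)`, where `B_ρ(x)` is the open ball. -/
def rhoLaplacianFun (μ : Measure X) (ρ : ℝ) (u : X → ℝ) (x : X) : ℝ :=
  1 / (ρ ^ 2 * μ.real (ball x ρ)) * ∫ y in ball x ρ, (u x - u y) ∂μ

variable [CompactSpace X] [BorelSpace X] (μ : Measure X) [IsFiniteMeasure μ]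

/-- By compactness, `μ(B_ρ(x))` is bounded below on the support of `μ`. -/
lemma exists_ball_lower_bound {ρ : ℝ} (hρ : 0 < ρ) :
    ∃ c : ℝ, 0 < c ∧ ∀ x ∈ μ.support, c ≤ μ.real (ball x ρ) := by
  obtain ⟨t, -, htf, hcov⟩ := finite_cover_balls_of_compact (isCompact_univ : IsCompact (univ : Set X))
    (half_pos hρ)
  let S : Finset X := htf.toFinset.filter (fun z => 0 < μ.real (ball z (ρ / 2)))
  obtain ⟨c, hc, hcS⟩ : ∃ c : ℝ, 0 < c ∧ ∀ z ∈ S, c ≤ μ.real (ball z (ρ / 2)) := by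
    by_cases hS : S.Nonempty
    · obtain ⟨z, hz, hmin⟩ := S.exists_min_image (fun z => μ.real (ball z (ρ / 2))) hS
      exact ⟨_, (Finset.mem_filter.1 hz).2, hmin⟩
    · exact ⟨1, one_pos, fun z hz => (hS ⟨z, hz⟩).elim⟩
  refine ⟨c, hc, fun x hx => ?_⟩
  obtain ⟨z, hzt, hxz⟩ := mem_iUnion₂.1 (hcov (mem_univ x))
  have hpos : 0 < μ.real (ball z (ρ / 2)) :=
    ENNReal.toReal_pos ((Measure.mem_support_iff_forall x).1 hx _ (isOpen_ball.mem_nhds hxz)).ne'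
      (measure_ne_top _ _)
  refine (hcS z (Finset.mem_filter.2 ⟨htf.mem_toFinset.2 hzt, hpos⟩)).trans
    (measureReal_mono (ball_subset_ball' ?_))
  have := mem_ball.1 hxz
  rw [dist_comm] at this
  linarith

lemma exists_rhoLaplacianFun_bound (ρ : ℝ) :
    ∃ M : ℝ, 0 ≤ M ∧ ∀ u : Lp ℝ 2 μ, ∀ᵐ x ∂μ,
      ‖rhoLaplacianFun μ ρ u x‖ ≤ M * (‖u x‖ + ‖u‖) := by
  rcases le_or_gt ρ 0 with hρ | hρ
  · exact ⟨0, le_rfl, fun u => ae_of_all _ fun x => by simp [rhoLaplacianFun, ball_eq_empty.2 hρ]⟩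
  obtain ⟨c, hc, hcx⟩ := exists_ball_lower_bound μ hρ
  set K : ℝ := (μ.real univ) ^ (1 / 2 : ℝ)
  have hK : 0 ≤ K := by positivity
  refine ⟨1 / (ρ ^ 2 * c) * (μ.real univ + K), by positivity, fun u => ?_⟩
  have hu : Integrable u μ := (Lp.memLp u).integrable one_le_two
  have hL1 : ∫ y, ‖u y‖ ∂μ ≤ K * ‖u‖ := by
    have h := eLpNorm_le_eLpNorm_mul_rpow_measure_univ (μ := μ) (f := u) (p := 1) (q := 2)
      one_le_two (Lp.aestronglyMeasurable u)
    have h2 := ENNReal.toReal_mono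
      (ENNReal.mul_ne_top (Lp.eLpNorm_ne_top u) (ENNReal.rpow_ne_top_of_nonneg (by norm_num)
        (measure_ne_top μ univ))) h
    rw [eLpNorm_one_eq_lintegral_enorm, ← integral_norm_eq_lintegral_enorm hu.1, ENNReal.toReal_mul,
      ← Lp.norm_def, ← ENNReal.toReal_rpow, mul_comm] at h2
    have he : 1 / (1 : ℝ≥0∞).toReal - 1 / (2 : ℝ≥0∞).toReal = 1 / 2 := by norm_num
    rw [he] at h2
    exact h2
  filter_upwards [Measure.support_mem_ae (μ := μ)] with x hx
  have hcb := hcx x hx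
  have h1 : ‖∫ y in ball x ρ, (u x - u y) ∂μ‖ ≤ μ.real univ * ‖u x‖ + K * ‖u‖ := by
    have hi : Integrable (fun y => ‖u x‖ + ‖u y‖) μ := (integrable_const _).add hu.norm
    calc ‖∫ y in ball x ρ, (u x - u y) ∂μ‖
        ≤ ∫ y in ball x ρ, ‖u x‖ + ‖u y‖ ∂μ :=
          norm_integral_le_of_norm_le hi.integrableOn (ae_of_all _ fun y => norm_sub_le _ _)
      _ ≤ ∫ y, ‖u x‖ + ‖u y‖ ∂μ :=
          setIntegral_le_integral hi (ae_of_all _ fun y => by positivity)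
      _ = μ.real univ * ‖u x‖ + ∫ y, ‖u y‖ ∂μ := by
          rw [integral_add (integrable_const _) hu.norm]; simp
      _ ≤ _ := by gcongr
  have hm : 0 ≤ μ.real univ := measureReal_nonneg
  rw [rhoLaplacianFun, norm_mul, mul_assoc]
  refine mul_le_mul ?_ (h1.trans ?_) (norm_nonneg _) (by positivity)
  · rw [Real.norm_of_nonneg (by positivity)]
    gcongr
  · nlinarith [mul_nonneg hm (norm_nonneg u), mul_nonneg hK (norm_nonneg (u x))]

lemma rhoLaplacianFun_aestronglyMeasurable (ρ : ℝ) (u : Lp ℝ 2 μ) :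
    AEStronglyMeasurable (rhoLaplacianFun μ ρ u) μ := by
  have hu : StronglyMeasurable (u : X → ℝ) := Lp.stronglyMeasurable u
  have hS : MeasurableSet {p : X × X | dist p.2 p.1 < ρ} :=
    (isOpen_lt (by fun_prop) continuous_const).measurableSet
  have h1 : StronglyMeasurable fun x => ∫ y in ball x ρ, (u x - u y) ∂μ := by
    have : (fun x => ∫ y in ball x ρ, (u x - u y) ∂μ) = fun x => ∫ y,
        {p : X × X | dist p.2 p.1 < ρ}.indicator (fun p => u p.1 - u p.2) (x, y) ∂μ := by
      funext x
      rw [← integral_indicator measurableSet_ball]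
      rfl
    rw [this]
    exact StronglyMeasurable.integral_prod_right
      (f := fun x y => {p : X × X | dist p.2 p.1 < ρ}.indicator (fun p => u p.1 - u p.2) (x, y))
      (((hu.comp_measurable measurable_fst).sub (hu.comp_measurable measurable_snd)).indicator hS)
  have h2 : Measurable fun x => μ.real (ball x ρ) :=
    (measurable_measure_prodMk_left (ν := μ) hS).ennreal_toReal
  exact ((((measurable_const.mul h2).const_div 1).stronglyMeasurable).mul h1).aestronglyMeasurable

lemma rhoLaplacianFun_memLp (ρ : ℝ) (u : Lp ℝ 2 μ) : MemLp (rhoLaplacianFun μ ρ u) 2 μ := by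
  obtain ⟨M, -, hM⟩ := exists_rhoLaplacianFun_bound μ ρ
  refine MemLp.mono' (g := fun x => M * (‖u x‖ + ‖u‖)) ?_
    (rhoLaplacianFun_aestronglyMeasurable μ ρ u) (hM u)
  exact ((Lp.memLp u).norm.add (memLp_const _)).const_mul M

/-- The `ρ`-Laplacian of the metric-measure space `(X, d, μ)`, as a bounded operator on the real
Hilbert space `L²(X, μ)`. -/
def rhoLaplacian (ρ : ℝ) : Lp ℝ 2 μ →L[ℝ] Lp ℝ 2 μ :=
  LinearMap.mkContinuousOfExistsBound
    { toFun := fun u => (rhoLaplacianFun_memLp μ ρ u).toLp _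
      map_add' := fun u v => by
        rw [← MemLp.toLp_add, MemLp.toLp_eq_toLp_iff]
        have hu : Integrable u μ := (Lp.memLp u).integrable one_le_two
        have hv : Integrable v μ := (Lp.memLp v).integrable one_le_two
        filter_upwards [Lp.coeFn_add u v] with x hx
        simp only [rhoLaplacianFun, Pi.add_apply]
        have hi := integral_add (μ := μ.restrict (ball x ρ))
          (f := fun y => u x - u y) (g := fun y => v x - v y)
          ((integrable_const (u x)).sub hu.restrict) ((integrable_const (v x)).sub hv.restrict)
        rw [← mul_add, ← hi]
        refine congrArg _ ?_
        refine setIntegral_congr_ae measurableSet_ball ?_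
        filter_upwards [Lp.coeFn_add u v] with y hy _
        rw [hx, hy]
        simp only [Pi.add_apply]
        ring
      map_smul' := fun c u => by
        rw [RingHom.id_apply, ← MemLp.toLp_const_smul, MemLp.toLp_eq_toLp_iff]
        filter_upwards [Lp.coeFn_smul c u] with x hx
        simp only [rhoLaplacianFun, Pi.smul_apply, smul_eq_mul]
        rw [mul_left_comm, ← integral_const_mul c]
        refine congrArg _ ?_
        refine setIntegral_congr_ae measurableSet_ball ?_
        filter_upwards [Lp.coeFn_smul c u] with y hy _
        rw [hx, hy]
        simp only [Pi.smul_apply, smul_eq_mul]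
        ring }
    (by
      obtain ⟨M, hM0, hM⟩ := exists_rhoLaplacianFun_bound μ ρ
      refine ⟨M * (1 + μ.real univ ^ (1 / (2 : ℝ≥0∞).toReal)), fun u => ?_⟩
      have hg : ‖(rhoLaplacianFun_memLp μ ρ u).toLp _‖ ≤
          M * ‖|u| + Lp.const 2 μ ‖u‖‖ := by
        refine Lp.norm_le_mul_norm_of_ae_le_mul ?_
        filter_upwards [hM u, (rhoLaplacianFun_memLp μ ρ u).coeFn_toLp, Lp.coeFn_abs u,
          Lp.coeFn_const 2 μ ‖u‖, Lp.coeFn_add |u| (Lp.const 2 μ ‖u‖)] with x h1 h2 h3 h4 h5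
        rw [h2, h5]
        simp only [Pi.add_apply, h3, h4, Function.const_apply]
        rw [Real.norm_of_nonneg (add_nonneg (abs_nonneg _) (norm_nonneg u))]
        exact h1
      have hc : ‖Lp.const 2 μ ‖u‖‖ ≤ ‖u‖ * μ.real univ ^ (1 / (2 : ℝ≥0∞).toReal) := by
        simpa using Lp.norm_const_le (p := 2) (μ := μ) (c := ‖u‖)
      calc _ ≤ M * ‖|u| + Lp.const 2 μ ‖u‖‖ := hg
        _ ≤ M * (‖|u|‖ + ‖Lp.const 2 μ ‖u‖‖) := by gcongr; exact norm_add_le _ _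
        _ ≤ M * (‖u‖ + ‖u‖ * μ.real univ ^ (1 / (2 : ℝ≥0∞).toReal)) := by
          rw [norm_abs_eq_norm]; gcongr
        _ = _ := by ring)

/-- The operator is given almost everywhere by the pointwise formula. -/
lemma rhoLaplacian_coeFn (ρ : ℝ) (u : Lp ℝ 2 μ) :
    rhoLaplacian μ ρ u =ᵐ[μ] rhoLaplacianFun μ ρ u :=
  (rhoLaplacianFun_memLp μ ρ u).coeFn_toLp

end Laplacian

section Spectrum

variable {H : Type*} [NormedAddCommGroup H] [NormedSpace ℝ H]

/-- The eigenspace of `T` for the real number `t`. -/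
def eigenspace (T : H →L[ℝ] H) (t : ℝ) : Submodule ℝ H :=
  Module.End.eigenspace (T : Module.End ℝ H) t

/-- `t` is an eigenvalue of `T`. -/
def IsEigenvalue (T : H →L[ℝ] H) (t : ℝ) : Prop :=
  Module.End.HasEigenvalue (T : Module.End ℝ H) t

/-- The discrete spectrum: the eigenvalues of finite multiplicity that are isolated points of the
spectrum. -/
def discreteSpectrum (T : H →L[ℝ] H) : Set ℝ :=
  {t | t ∈ spectrum ℝ T ∧ ¬ AccPt t (Filter.principal (spectrum ℝ T)) ∧
    IsEigenvalue T t ∧ FiniteDimensional ℝ (eigenspace T t)}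

/-- The essential spectrum: the part of the spectrum that is not discrete. -/
def essentialSpectrum (T : H →L[ℝ] H) : Set ℝ :=
  spectrum ℝ T \ discreteSpectrum T

/-- `λ_∞`, the infimum of the essential spectrum, which is `+∞` if there is none. -/
def lambdaInfty (T : H →L[ℝ] H) : EReal :=
  ⨅ t ∈ essentialSpectrum T, (t : EReal)

/-- The number of eigenvalues `≤ t` counted with multiplicities, that is, the dimension of the
(automatically direct) sum of the eigenspaces for the eigenvalues `≤ t`. -/
def eigenvalueCount (T : H →L[ℝ] H) (t : ℝ) : Cardinal :=
  Module.rank ℝ ↥(⨆ s ∈ Iic t, eigenspace T s)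

/-- The `k`-th eigenvalue (`k = 1, 2, …`) below the essential spectrum: the smallest
eigenvalue `t < λ_∞` such that at least `k` eigenvalues, counted with multiplicities, are `≤ t`.
If there is no such `t`, that is, if fewer than `k` eigenvalues are smaller than `λ_∞`, the value
is `λ_∞`. -/
def kthEigenvalue (T : H →L[ℝ] H) (k : ℕ) : EReal :=
  min (lambdaInfty T)
    (⨅ t ∈ {t : ℝ | IsEigenvalue T t ∧ (t : EReal) < lambdaInfty T ∧
      (k : Cardinal) ≤ eigenvalueCount T t}, (t : EReal))

end Spectrum

/-- `λ_k(X, ρ)`, an element of `[0, +∞]`; the numbering starts with `k = 1`. -/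
def lambda {X : Type*} [PseudoMetricSpace X] [CompactSpace X] [MeasurableSpace X] [BorelSpace X]
    (μ : Measure X) [IsFiniteMeasure μ] (ρ : ℝ) (k : ℕ) : EReal :=
  kthEigenvalue (rhoLaplacian μ ρ) k

/-- Relative `(ε, δ)`-closeness of two measures on a (semi-)metric space. The closed neighborhood
`{z | d(z, A) ≤ ε}` is `Metric.cthickening ε A`. -/
def RelativelyClose {Z : Type*} [PseudoMetricSpace Z] [MeasurableSpace Z]
    (μ₁ μ₂ : Measure Z) (ε δ : ℝ) : Prop :=
  ∀ A : Set Z, MeasurableSet A →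
    μ₂ A ≤ ENNReal.ofReal (Real.exp δ) * μ₁ (cthickening ε A) ∧
    μ₁ A ≤ ENNReal.ofReal (Real.exp δ) * μ₂ (cthickening ε A)

/-- `(ε, δ)`-closeness of metric-measure spaces: there is a semi-metric on `X ⊔ Y` that extends the
metrics of `X` and `Y` and for which the two measures, pushed forward to `X ⊔ Y` with its Borel
`σ`-algebra, are relatively `(ε, δ)`-close. -/
def AreClose {X Y : Type*} [PseudoMetricSpace X] [MeasurableSpace X] [BorelSpace X]
    [PseudoMetricSpace Y] [MeasurableSpace Y] [BorelSpace Y]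
    (μX : Measure X) (μY : Measure Y) (ε δ : ℝ) : Prop :=
  ∃ d : PseudoMetricSpace (X ⊕ Y),
    (∀ x x' : X, d.dist (Sum.inl x) (Sum.inl x') = dist x x') ∧
    (∀ y y' : Y, d.dist (Sum.inr y) (Sum.inr y') = dist y y') ∧
    letI : PseudoMetricSpace (X ⊕ Y) := d
    letI : MeasurableSpace (X ⊕ Y) := @borel (X ⊕ Y) d.toUniformSpace.toTopologicalSpace
    RelativelyClose (μX.map Sum.inl) (μY.map Sum.inr) ε δ

section Conditions

variable {X : Type*} [PseudoMetricSpace X] [MeasurableSpace X]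

/-- The spherical layer volume condition `SLV(Λ, ρ, ε)`. -/
def SLV (μ : Measure X) (Λ ρ ε : ℝ) : Prop :=
  ∀ x ∈ μ.support, μ.real (ball x (ρ + ε) \ ball x ρ) / μ.real (ball x ρ) ≤ Λ * (ε / ρ)

/-- The ball intersection volume condition `BIV(Λ, ρ, ε)`. -/
def BIV (μ : Measure X) (Λ ρ ε : ℝ) : Prop :=
  ∀ x ∈ μ.support, ∀ y ∈ μ.support, dist x y ≤ ρ + ε →
    Λ⁻¹ * μ.real (ball x (ρ + ε)) ≤ μ.real (ball x ρ ∩ ball y ρ)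

end Conditions

end

end MMSpace

/-! The eigenvalues are compared by min-max. Let `m(x)` be the volume of the `ρ`-ball at `x`.
Multiplication by `√m` conjugates the `ρ`-Laplacian to `ρ⁻²(1 - B)` with `B` compact and symmetric
(`conj_rhoLaplacian`, `isCompactOperator_kernelOp`), so the spectrum below `ρ⁻²` is discrete. There
`λ_k` is governed by the `k`-dimensional spaces of functions on which the averaging form is at least
`1 - sρ²` times the norm weighted by `m` (`exists_submodule_of_lambda_lt`,
`lambda_le_of_submodule`). The weighted norm minus the averaging form is half the integral of `(u x
- u y)²` over the pairs at distance less than `ρ`.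

Such spaces are carried from `X` to `Y` by a measure `γ` on `X × Y` living on pairs at distance at
most `ε`, whose second marginal is `μY` and whose first marginal agrees with `μX` up to the factor
`e^δ`. It comes from a marriage theorem (`exists_coupling`), proved by M. Riesz extension and
Riesz–Markov. A function on `X` is pulled back to `X × Y` and averaged over the fibres over `Y`;
exactness of the second marginal makes this averaging an adjoint of an isometry.

On the support of `γ` distances are distorted by at most `2ε`. Hence the Dirichlet form upstairs
costs `e^{2δ}` and an enlargement of the radius to `ρ + 2ε`, undone by `dirichletLIntegral_enlarge`
at the price of a factor `1 + O(ε/ρ)`: the ball intersection condition bounds `(w x - w y)²` by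
local averages, and the spherical layer condition says that few pairs are added. The weighted norm
likewise loses `e^{2δ}(1 + O(ε/ρ))`. Averaging over the fibres keeps the averaging form and does not
increase the weighted norm, so Rayleigh quotients get worse by at most `e^{4δ}(1 + Cε/ρ)` in all
(`exists_submodule_transfer`). Exchanging `X` and `Y` gives the second inequality. -/

namespace MMSpace

/-! ### Quadratic forms of compact symmetric operators. -/

section CompactSelfAdjoint

open Module.End

variable {H : Type*} [NormedAddCommGroup H] [InnerProductSpace ℝ H]

lemma inner_eq_zero_of_mem_eigenspace {B : H →L[ℝ] H} (hB : B.IsSymmetric) {β γ : ℝ}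
    (h : β ≠ γ) {x y : H} (hx : x ∈ Module.End.eigenspace (B : Module.End ℝ H) β)
    (hy : y ∈ Module.End.eigenspace (B : Module.End ℝ H) γ) : inner ℝ x y = 0 :=
  hB.orthogonalFamily_eigenspaces h ⟨x, hx⟩ ⟨y, hy⟩

/-- Bounds on the eigenvalues bound the quadratic form from below on the sum of the eigenspaces. -/
lemma mul_norm_sq_le_inner_of_mem_iSup_eigenspace {B : H →L[ℝ] H} (hB : B.IsSymmetric)
    {S : Set ℝ} {c : ℝ} (hS : ∀ β ∈ S, c ≤ β) {x : H}
    (hx : x ∈ ⨆ β ∈ S, Module.End.eigenspace (B : Module.End ℝ H) β) :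
    c * ‖x‖ ^ 2 ≤ inner ℝ (B x) x := by
  rw [iSup_subtype', Submodule.mem_iSup_iff_exists_finsupp] at hx
  obtain ⟨f, hf, rfl⟩ := hx
  have horth : ∀ i j : S, i ≠ j → inner ℝ (f i) (f j) = 0 := fun i j hij =>
    inner_eq_zero_of_mem_eigenspace hB (fun h => hij (Subtype.ext h)) (hf i) (hf j)
  have hBf : ∀ i : S, B (f i) = (i : ℝ) • f i := fun i => mem_eigenspace_iff.1 (hf i)
  -- The eigenspaces are orthogonal, so the form of `B - c` is diagonal on the sum.
  have key : inner ℝ (B (∑ i ∈ f.support, f i)) (∑ i ∈ f.support, f i) -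
      c * ‖∑ i ∈ f.support, f i‖ ^ 2 = ∑ i ∈ f.support, ((i : ℝ) - c) * ‖f i‖ ^ 2 := by
    rw [← real_inner_self_eq_norm_sq, ← real_inner_smul_left, ← inner_sub_left, map_sum, Finset.smul_sum,
      ← Finset.sum_sub_distrib, sum_inner]
    refine Finset.sum_congr rfl fun i hi => ?_
    rw [inner_sum, Finset.sum_eq_single i]
    · rw [hBf, ← sub_smul, real_inner_smul_left, real_inner_self_eq_norm_sq]
    · intro j _ hji
      rw [hBf, ← sub_smul, real_inner_smul_left, horth i j hji.symm, mul_zero]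
    · exact fun h => (h hi).elim
  change c * ‖∑ i ∈ f.support, f i‖ ^ 2 ≤ inner ℝ (B (∑ i ∈ f.support, f i)) (∑ i ∈ f.support, f i)
  have : 0 ≤ ∑ i ∈ f.support, ((i : ℝ) - c) * ‖f i‖ ^ 2 :=
    Finset.sum_nonneg fun i _ => mul_nonneg (sub_nonneg.2 (hS i i.2)) (sq_nonneg _)
  linarith

/-- Apply the lower bound to `-B`, whose eigenvalues are the negated ones. -/
lemma inner_le_mul_norm_sq_of_mem_iSup_eigenspace {B : H →L[ℝ] H} (hB : B.IsSymmetric)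
    {S : Set ℝ} {c : ℝ} (hS : ∀ β ∈ S, β ≤ c) {x : H}
    (hx : x ∈ ⨆ β ∈ S, Module.End.eigenspace (B : Module.End ℝ H) β) :
    inner ℝ (B x) x ≤ c * ‖x‖ ^ 2 := by
  have hB' : (-B).IsSymmetric := fun u v => by
    have := hB u v
    simp only [ContinuousLinearMap.coe_coe] at this
    simp [this]
  have hx' : x ∈ ⨆ β ∈ -S, Module.End.eigenspace ((-B : H →L[ℝ] H) : Module.End ℝ H) β := by
    refine (iSup₂_le fun β hβ => ?_ : (⨆ β ∈ S, Module.End.eigenspace (B : Module.End ℝ H) β) ≤ _) hx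
    refine le_trans (fun y hy => ?_) (le_iSup₂_of_le (-β) (by simpa using hβ) le_rfl)
    rw [mem_eigenspace_iff] at hy ⊢
    simpa using hy
  have := mul_norm_sq_le_inner_of_mem_iSup_eigenspace hB' (c := -c)
    (fun β hβ => by have := hS (-β) hβ; linarith) hx'
  simp only [neg_mul, neg_apply, inner_neg_left] at this
  linarith

/-- A compact symmetric operator has only finitely many eigenvalues above a positive number. -/
lemma finite_setOf_le_eigenvalue {B : H →L[ℝ] H} (hB : B.IsSymmetric)
    (hc : IsCompactOperator B) {c : ℝ} (hcpos : 0 < c) :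
    {β : ℝ | c ≤ β ∧ HasEigenvalue (B : Module.End ℝ H) β}.Finite := by
  by_contra hinf
  obtain ⟨b, hbinj, hb⟩ : ∃ b : ℕ → ℝ, Function.Injective b ∧
      ∀ n, c ≤ b n ∧ HasEigenvalue (B : Module.End ℝ H) (b n) :=
    ⟨fun n => Set.Infinite.natEmbedding _ hinf n,
      fun m n h => (Set.Infinite.natEmbedding _ hinf).injective (Subtype.ext h),
      fun n => (Set.Infinite.natEmbedding _ hinf n).2⟩
  have hex : ∀ n, ∃ e : H, e ∈ Module.End.eigenspace (B : Module.End ℝ H) (b n) ∧ ‖e‖ = 1 := fun n => by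
    obtain ⟨v, hv⟩ := (hb n).2.exists_hasEigenvector
    refine ⟨‖v‖⁻¹ • v, Submodule.smul_mem _ _ hv.1, ?_⟩
    rw [norm_smul, norm_inv, norm_norm, inv_mul_cancel₀ (norm_ne_zero_iff.2 hv.2)]
  choose e he hnorm using hex
  have horth : ∀ m n, m ≠ n → inner ℝ (e m) (e n) = 0 := fun m n hmn =>
    inner_eq_zero_of_mem_eigenspace hB
      (fun h => hmn (hbinj h)) (he m) (he n)
  have hBe : ∀ n, B (e n) = (b n) • e n := fun n => mem_eigenspace_iff.1 (he n)
  -- Orthonormal eigenvectors with eigenvalues at least `c` have images at mutual distance at least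
  -- `c`, so the images have no convergent subsequence.
  have hsep : ∀ m n, m ≠ n → c ^ 2 ≤ ‖B (e m) - B (e n)‖ ^ 2 := fun m n hmn => by
    rw [hBe, hBe, norm_sub_sq_real, real_inner_smul_left, real_inner_smul_right, horth m n hmn,
      norm_smul, norm_smul, hnorm, hnorm, mul_one, mul_one]
    simp only [Real.norm_eq_abs, sq_abs]
    have := (hb m).1
    nlinarith [sq_nonneg (b n)]
  obtain ⟨K, hK, hKsub⟩ := hc.image_closedBall_subset_compact (f := (B : H →ₗ[ℝ] H)) 1
  obtain ⟨a, -, φ, hφ, hlim⟩ := hK.tendsto_subseq (x := fun n => B (e n))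
    fun n => hKsub ⟨e n, by simp [hnorm], rfl⟩
  obtain ⟨N, hN⟩ := Metric.cauchySeq_iff'.1 hlim.cauchySeq c hcpos
  have h1 := hN (N + 1) (Nat.le_succ N)
  rw [dist_eq_norm] at h1
  have h2 := hsep (φ (N + 1)) (φ N) (hφ (Nat.lt_succ_self N)).ne'
  have h3 : c ≤ ‖B (e (φ (N + 1))) - B (e (φ N))‖ :=
    (sq_le_sq₀ hcpos.le (norm_nonneg _)).1 h2
  exact absurd h1 (not_lt.2 h3)

/-- Off the sum of the eigenspaces for the eigenvalues `≥ c`, the quadratic form is at most `c`. -/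
lemma inner_le_mul_norm_sq_of_mem_orthogonal [CompleteSpace H] {B : H →L[ℝ] H}
    (hB : B.IsSymmetric) (hc : IsCompactOperator B) {c : ℝ} {w : H}
    (hw : w ∈ (⨆ β ∈ Ici c, Module.End.eigenspace (B : Module.End ℝ H) β)ᗮ) :
    inner ℝ (B w) w ≤ c * ‖w‖ ^ 2 := by
  set F := ⨆ β ∈ Ici c, Module.End.eigenspace (B : Module.End ℝ H) β
  set G := ⨆ β ∈ Iio c, Module.End.eigenspace (B : Module.End ℝ H) β
  have hGF : G ≤ Fᗮ := by
    refine iSup₂_le fun β hβ => ?_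
    have hF : F ≤ (Module.End.eigenspace (B : Module.End ℝ H) β)ᗮ :=
      iSup₂_le fun β' hβ' x hx => (Submodule.mem_orthogonal _ _).2 fun y hy =>
        inner_eq_zero_of_mem_eigenspace hB (ne_of_lt (lt_of_lt_of_le hβ hβ')) hy hx
    refine fun x hx => (Submodule.mem_orthogonal _ _).2 fun y hy => ?_
    rw [real_inner_comm]
    exact (Submodule.mem_orthogonal _ _).1 (hF hy) x hx
  have htop : ∀ x ∈ Gᗮ, x ∈ Fᗮ → x = 0 := fun x hxG hxF => by
    have : x ∈ (⨆ β, Module.End.eigenspace (B : Module.End ℝ H) β)ᗮ := by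
      rw [Submodule.mem_orthogonal] at *
      intro y hy
      have hle : (⨆ β, Module.End.eigenspace (B : Module.End ℝ H) β) ≤ F ⊔ G :=
        iSup_le fun β => by
          rcases le_or_gt c β with h | h
          · exact le_sup_of_le_left (le_iSup₂_of_le β h le_rfl)
          · exact le_sup_of_le_right (le_iSup₂_of_le β h le_rfl)
      obtain ⟨p, hp, q, hq, rfl⟩ := Submodule.mem_sup.1 (hle hy)
      rw [inner_add_left, hxF p hp, hxG q hq, add_zero]
    rw [ContinuousLinearMap.orthogonalComplement_iSup_eigenspaces_eq_bot hc hB] at this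
    exact (Submodule.mem_bot ℝ).1 this
  -- The eigenspaces span a dense subspace, so only `0` is orthogonal to both `F` and `G`. Hence
  -- `w`, being orthogonal to `F`, lies in the closure of `G`, where the bound persists by
  -- continuity.
  have hcl : w ∈ G.topologicalClosure := by
    rw [← Submodule.orthogonal_orthogonal_eq_closure, Submodule.mem_orthogonal]
    have hGG : G.topologicalClosure ≤ Fᗮ :=
      G.topologicalClosure_minimal hGF (Submodule.isClosed_orthogonal F)
    have : CompleteSpace G.topologicalClosure :=
      (Submodule.isClosed_topologicalClosure G).completeSpace_coe
    obtain ⟨p, hp, q, hq, hpq⟩ :=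
      Submodule.exists_add_mem_mem_orthogonal (K := G.topologicalClosure) w
    have hq' : q = 0 := by
      refine htop q ?_ ?_
      · exact Submodule.orthogonal_le (Submodule.le_topologicalClosure G) hq
      · have : q = w - p := by rw [hpq]; abel
        rw [this]
        exact Submodule.sub_mem _ hw (hGG hp)
    intro u hu
    rw [hpq, hq', add_zero, real_inner_comm]
    rw [← Submodule.orthogonal_orthogonal_eq_closure] at hp
    rw [real_inner_comm]
    exact (Submodule.mem_orthogonal _ _).1 hp u hu
  have hclosed : IsClosed {x : H | inner ℝ (B x) x ≤ c * ‖x‖ ^ 2} :=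
    isClosed_le (by fun_prop) (by fun_prop)
  have hsub : (G : Set H) ⊆ {x : H | inner ℝ (B x) x ≤ c * ‖x‖ ^ 2} := fun x hx =>
    inner_le_mul_norm_sq_of_mem_iSup_eigenspace hB (S := Iio c) (fun β hβ => le_of_lt hβ) hx
  exact closure_minimal hsub hclosed hcl

end CompactSelfAdjoint

/-! ### Min-max for `r(1 - B)` with `B` compact and symmetric. -/

section IdSubCompact

variable {H : Type*} [NormedAddCommGroup H] [InnerProductSpace ℝ H] {B : H →L[ℝ] H} {r : ℝ}

/-- Spectral data of `r(1 - B)` are read off from `B` by the substitution `t ↦ 1 - t / r`. For `r >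
0` it is decreasing and sends `t < r` to positive numbers, where compactness of `B` controls the
spectrum. -/
lemma eigenspace_smul_one_sub (hr : r ≠ 0) (t : ℝ) :
    eigenspace (r • (1 - B)) t = Module.End.eigenspace (B : Module.End ℝ H) (1 - t / r) := by
  ext x
  rw [eigenspace, Module.End.mem_eigenspace_iff, Module.End.mem_eigenspace_iff]
  simp only [ContinuousLinearMap.coe_coe, smul_apply,
    sub_apply, one_apply_eq_self, sub_smul, one_smul]
  constructor
  · intro h
    have : x - B x = (t / r) • x := by
      rw [div_eq_inv_mul, mul_smul, ← h, smul_smul, inv_mul_cancel₀ hr, one_smul]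
    rw [← this]; abel
  · intro h
    rw [h, sub_sub_cancel, smul_smul, mul_div_cancel₀ _ hr]

lemma mem_spectrum_smul_one_sub (hr : r ≠ 0) {t : ℝ} :
    t ∈ spectrum ℝ (r • (1 - B)) ↔ 1 - t / r ∈ spectrum ℝ B := by
  have h : algebraMap ℝ (H →L[ℝ] H) t - r • (1 - B) =
      Units.mk0 (-r) (neg_ne_zero.2 hr) • (algebraMap ℝ (H →L[ℝ] H) (1 - t / r) - B) := by
    ext x
    change t • x - r • (x - B x) = (-r) • ((1 - t / r) • x - B x)
    have : r * (t / r) = t := mul_div_cancel₀ _ hr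
    simp only [smul_sub, sub_smul, smul_smul, one_smul, neg_smul, neg_mul, this]
    abel
  rw [spectrum.mem_iff, spectrum.mem_iff, h, isUnit_smul_iff]

variable [CompleteSpace H]

lemma isEigenvalue_of_mem_spectrum (hr : 0 < r) (hc : IsCompactOperator B) {t : ℝ} (ht : t < r)
    (h : t ∈ spectrum ℝ (r • (1 - B))) : IsEigenvalue (r • (1 - B)) t := by
  have hb : (1 - t / r) ≠ 0 := by
    have := (div_lt_one hr).2 ht
    linarith
  have := (hc.hasEigenvalue_iff_mem_spectrum hb).2 ((mem_spectrum_smul_one_sub hr.ne').1 h)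
  rw [IsEigenvalue, Module.End.hasEigenvalue_iff]
  rw [Module.End.hasEigenvalue_iff, ← eigenspace_smul_one_sub hr.ne'] at this
  exact this

omit [CompleteSpace H] in
lemma finite_setOf_isEigenvalue_le (hr : 0 < r) (hB : B.IsSymmetric) (hc : IsCompactOperator B)
    {t : ℝ} (ht : t < r) : {s : ℝ | s ≤ t ∧ IsEigenvalue (r • (1 - B)) s}.Finite := by
  have hpos : 0 < 1 - t / r := by
    have := (div_lt_one hr).2 ht
    linarith
  refine Finite.of_finite_image (f := fun s => 1 - s / r)
    ((finite_setOf_le_eigenvalue hB hc hpos).subset ?_) ?_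
  · rintro _ ⟨s, ⟨hs, hse⟩, rfl⟩
    refine ⟨?_, ?_⟩
    · have : s / r ≤ t / r := div_le_div_of_nonneg_right hs hr.le
      simp only; linarith
    rw [Module.End.hasEigenvalue_iff, ← eigenspace_smul_one_sub hr.ne']
    exact Module.End.hasEigenvalue_iff.1 hse
  · intro s _ s' _ h
    have : s / r = s' / r := by simp only at h; linarith
    exact (div_left_inj' hr.ne').1 this

/-- If `t` were an accumulation point, infinitely many spectral values would lie below some `t' <
r`. They would all be eigenvalues by the Fredholm alternative, and there are only finitely many of
these. -/
lemma mem_discreteSpectrum_of_lt (hr : 0 < r) (hB : B.IsSymmetric) (hc : IsCompactOperator B)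
    {t : ℝ} (ht : t < r) (h : t ∈ spectrum ℝ (r • (1 - B))) :
    t ∈ discreteSpectrum (r • (1 - B)) := by
  refine ⟨h, fun hacc => ?_, isEigenvalue_of_mem_spectrum hr hc ht h, ?_⟩
  · obtain ⟨t', htt', ht'⟩ := exists_between ht
    refine Set.Infinite.of_accPt (hacc.nhds_inter (Iio_mem_nhds htt')) ?_
    refine (finite_setOf_isEigenvalue_le hr hB hc ht').subset ?_
    rintro s ⟨hs, hss⟩
    exact ⟨le_of_lt hs, isEigenvalue_of_mem_spectrum hr hc (lt_trans hs ht') hss⟩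
  · rw [eigenspace_smul_one_sub hr.ne']
    refine ContinuousLinearMap.finite_dimensional_eigenspace hc _ ?_
    have := (div_lt_one hr).2 ht
    linarith

/-- Only an inequality: in finite dimension there is no essential spectrum and the right side is
`⊤`. -/
lemma le_lambdaInfty (hr : 0 < r) (hB : B.IsSymmetric) (hc : IsCompactOperator B) :
    (r : EReal) ≤ lambdaInfty (r • (1 - B)) := by
  refine le_iInf₂ fun t ht => ?_
  by_contra! hlt
  exact ht.2 (mem_discreteSpectrum_of_lt hr hB hc (EReal.coe_lt_coe_iff.1 hlt) ht.1)

omit [CompleteSpace H] in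
lemma iSup_eigenspace_smul_one_sub (hr : 0 < r) (t : ℝ) :
    (⨆ s ∈ Iic t, eigenspace (r • (1 - B)) s) =
      ⨆ β ∈ Ici (1 - t / r), Module.End.eigenspace (B : Module.End ℝ H) β := by
  refine le_antisymm (iSup₂_le fun s hs => ?_) (iSup₂_le fun β hβ => ?_)
  · rw [eigenspace_smul_one_sub hr.ne']
    refine le_iSup₂_of_le (1 - s / r) ?_ le_rfl
    have : s / r ≤ t / r := div_le_div_of_nonneg_right hs hr.le
    simp only [mem_Ici]; linarith
  · refine le_iSup₂_of_le (r * (1 - β)) ?_ ?_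
    · have h1 : 1 - β ≤ t / r := by simp only [mem_Ici] at hβ; linarith
      rw [le_div_iff₀ hr] at h1
      simp only [mem_Iic]; linarith
    · rw [eigenspace_smul_one_sub hr.ne', mul_div_cancel_left₀ _ hr.ne', sub_sub_cancel]

/-- If the `k`-th eigenvalue is small then the quadratic form is large on some `k`-dimensional
subspace. -/
theorem exists_submodule_of_kthEigenvalue_lt (hr : 0 < r) (hB : B.IsSymmetric)
    (hc : IsCompactOperator B) {k : ℕ} {s : ℝ} (hs : s ≤ r)
    (hk : kthEigenvalue (r • (1 - B)) k < s) :
    ∃ V : Submodule ℝ H, Module.finrank ℝ V = k ∧ FiniteDimensional ℝ V ∧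
      ∀ x ∈ V, (1 - s / r) * ‖x‖ ^ 2 ≤ inner ℝ (B x) x := by
  have hinf : (⨅ t ∈ {t : ℝ | IsEigenvalue (r • (1 - B)) t ∧
      (t : EReal) < lambdaInfty (r • (1 - B)) ∧
      (k : Cardinal) ≤ eigenvalueCount (r • (1 - B)) t}, (t : EReal)) < s := by
    -- Since `s ≤ r ≤ λ_∞`, the value below `s` comes from an eigenvalue and not from `λ_∞`.
    rcases min_lt_iff.1 hk with h | h
    · exact absurd ((EReal.coe_le_coe_iff.2 hs).trans (le_lambdaInfty hr hB hc)) (not_le.2 h)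
    · exact h
  obtain ⟨t, ht⟩ := iInf_lt_iff.1 hinf
  obtain ⟨⟨-, -, hcount⟩, hts⟩ := iInf_lt_iff.1 ht
  have hts : t < s := EReal.coe_lt_coe_iff.1 hts
  rw [eigenvalueCount, iSup_eigenspace_smul_one_sub hr, Module.le_rank_iff_exists_linearMap]
    at hcount
  obtain ⟨f, hf⟩ := hcount
  let g := Submodule.subtype _ ∘ₗ f
  have hg : Function.Injective g := (Submodule.injective_subtype _).comp hf
  -- The sum of eigenspaces may have rank larger than `k`; the range of an injection of `Fin k → ℝ`
  -- has dimension exactly `k`.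
  refine ⟨LinearMap.range g, ?_, inferInstance, ?_⟩
  · rw [LinearMap.finrank_range_of_inj hg, Module.finrank_fin_fun]
  · rintro _ ⟨y, rfl⟩
    refine mul_norm_sq_le_inner_of_mem_iSup_eigenspace hB (S := Ici (1 - t / r)) ?_ (f y).2
    intro β hβ
    have : t / r ≤ s / r := by gcongr
    simp only [mem_Ici] at hβ
    linarith

/-- If the quadratic form is large on some `k`-dimensional subspace then the `k`-th eigenvalue is
small. -/
theorem kthEigenvalue_le_of_submodule (hr : 0 < r) (hB : B.IsSymmetric)
    (hc : IsCompactOperator B) {k : ℕ} (hk : 1 ≤ k) {s : ℝ} (hs : s < r) {V : Submodule ℝ H}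
    (hV : Module.finrank ℝ V = k)
    (hform : ∀ x ∈ V, (1 - s / r) * ‖x‖ ^ 2 ≤ inner ℝ (B x) x) :
    kthEigenvalue (r • (1 - B)) k ≤ s := by
  -- The room `s < s'` makes the upper bound `1 - s'/r` on the form off `F` strictly smaller than
  -- the lower bound `1 - s/r` on `V`; afterwards `s'` tends to `s`.
  have hmain : ∀ s' : ℝ, s < s' → s' < r → kthEigenvalue (r • (1 - B)) k ≤ s' := by
    intro s' hss' hs'r
    set F := ⨆ t ∈ Iic s', eigenspace (r • (1 - B)) t with hF
    have hrank : (k : Cardinal) ≤ Module.rank ℝ F := by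
      by_contra! hlt
      have : FiniteDimensional ℝ F :=
        Module.rank_lt_aleph0_iff.1 (hlt.trans Cardinal.natCast_lt_aleph0)
      rw [← Module.finrank_eq_rank, Nat.cast_lt, ← hV] at hlt
      have : FiniteDimensional ℝ V := Module.finite_of_finrank_pos (by omega)
      -- If `dim F < dim V`, some nonzero vector of `V` is orthogonal to `F`, where the two bounds
      -- contradict each other.
      have hker := LinearMap.ker_ne_bot_of_finrank_lt
        (f := (F.orthogonalProjectionOnto : H →ₗ[ℝ] F) ∘ₗ V.subtype) hlt
      obtain ⟨w, hw, hw0⟩ := Submodule.exists_mem_ne_zero_of_ne_bot hker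
      have hwF : (w : H) ∈ Fᗮ := by
        have : F.orthogonalProjectionOnto (w : H) = 0 := hw
        exact Submodule.orthogonalProjectionOnto_eq_zero_iff.1 this
      rw [hF, iSup_eigenspace_smul_one_sub hr] at hwF
      have h1 := inner_le_mul_norm_sq_of_mem_orthogonal hB hc hwF
      have h2 := hform w w.2
      have h3 : 0 < ‖(w : H)‖ ^ 2 := by
        have : (w : H) ≠ 0 := fun h => hw0 (Subtype.ext h)
        positivity
      have h4 : s / r < s' / r := by gcongr
      nlinarith
    have hfin := finite_setOf_isEigenvalue_le hr hB hc hs'r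
    have hbot : ∀ t, ¬ IsEigenvalue (r • (1 - B)) t → eigenspace (r • (1 - B)) t = ⊥ := fun t ht => by
      by_contra h
      exact ht (Module.End.hasEigenvalue_iff.2 h)
    -- The infimum defining `kthEigenvalue` runs over eigenvalues only, so `s'` is replaced by the
    -- largest eigenvalue `t ≤ s'`. One exists because `F` has rank at least `k ≥ 1`, and no
    -- eigenspace is lost.
    have hne : {t : ℝ | t ≤ s' ∧ IsEigenvalue (r • (1 - B)) t}.Nonempty := by
      by_contra hemp
      rw [Set.not_nonempty_iff_eq_empty] at hemp
      have : F = ⊥ := by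
        rw [hF, eq_bot_iff]
        refine iSup₂_le fun t ht => (hbot t fun h => ?_).le
        exact (Set.eq_empty_iff_forall_notMem.1 hemp t) ⟨ht, h⟩
      rw [this, rank_bot] at hrank
      have : k ≤ 0 := by exact_mod_cast hrank
      omega
    obtain ⟨t, ⟨hts', hte⟩, hmax⟩ := hfin.exists_maximalFor id _ hne
    have hle : F ≤ ⨆ a ∈ Iic t, eigenspace (r • (1 - B)) a := by
      refine iSup₂_le fun a ha => ?_
      by_cases hae : IsEigenvalue (r • (1 - B)) a
      · refine le_iSup₂_of_le a ?_ le_rfl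
        rcases le_total a t with h | h
        · exact h
        · exact hmax ⟨ha, hae⟩ h
      · rw [hbot a hae]; exact bot_le
    refine (min_le_right _ _).trans ((iInf₂_le t ⟨hte, ?_, ?_⟩).trans (EReal.coe_le_coe_iff.2 hts'))
    · exact lt_of_lt_of_le (EReal.coe_lt_coe_iff.2 (lt_of_le_of_lt hts' hs'r))
        (le_lambdaInfty hr hB hc)
    · exact hrank.trans (Submodule.rank_mono hle)
  refine le_of_forall_gt_imp_ge_of_dense fun a ha => ?_
  obtain ⟨b, hb1, hb2⟩ := EReal.lt_iff_exists_real_btwn.1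
    (lt_min ha (EReal.coe_lt_coe_iff.2 hs))
  rw [lt_min_iff] at hb2
  exact (hmain b (EReal.coe_lt_coe_iff.1 hb1) (EReal.coe_lt_coe_iff.1 hb2.2)).trans hb2.1.le

end IdSubCompact

/-! ### Invariance of the spectral quantities under conjugation. -/

section Conjugation

variable {H : Type*} [NormedAddCommGroup H] [NormedSpace ℝ H] (J : H ≃L[ℝ] H) (T : H →L[ℝ] H)

lemma eigenspace_conj (t : ℝ) :
    eigenspace (J.conjContinuousAlgEquiv T) t =
      (eigenspace T t).map (J.toLinearEquiv : H →ₗ[ℝ] H) := by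
  ext x
  rw [Submodule.map_equiv_eq_comap_symm, Submodule.mem_comap, eigenspace, eigenspace,
    Module.End.mem_eigenspace_iff, Module.End.mem_eigenspace_iff]
  simp only [ContinuousLinearMap.coe_coe, ContinuousLinearEquiv.conjContinuousAlgEquiv_apply_apply,
    LinearEquiv.coe_coe]
  change J (T (J.symm x)) = t • x ↔ T (J.symm x) = t • J.symm x
  rw [← J.symm.injective.eq_iff, J.symm_apply_apply, map_smul]

lemma isEigenvalue_conj (t : ℝ) :
    IsEigenvalue (J.conjContinuousAlgEquiv T) t ↔ IsEigenvalue T t := by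
  rw [IsEigenvalue, IsEigenvalue, Module.End.hasEigenvalue_iff, Module.End.hasEigenvalue_iff]
  change eigenspace _ t ≠ ⊥ ↔ eigenspace T t ≠ ⊥
  rw [eigenspace_conj, Ne, Submodule.map_eq_bot_iff]

lemma eigenvalueCount_conj (t : ℝ) :
    eigenvalueCount (J.conjContinuousAlgEquiv T) t = eigenvalueCount T t := by
  have h : (⨆ s ∈ Iic t, eigenspace (J.conjContinuousAlgEquiv T) s) =
      (⨆ s ∈ Iic t, eigenspace T s).map (J.toLinearEquiv : H →ₗ[ℝ] H) := by
    simp only [eigenspace_conj, ← Submodule.map_iSup]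
  rw [eigenvalueCount, eigenvalueCount, h]
  exact (J.toLinearEquiv.submoduleMap (⨆ s ∈ Iic t, eigenspace T s)).symm.rank_eq

lemma spectrum_conj : spectrum ℝ (J.conjContinuousAlgEquiv T) = spectrum ℝ T :=
  AlgEquiv.spectrum_eq J.conjContinuousAlgEquiv.toAlgEquiv T

lemma discreteSpectrum_conj : discreteSpectrum (J.conjContinuousAlgEquiv T) = discreteSpectrum T := by
  ext t
  simp only [discreteSpectrum, mem_ofPred_eq, spectrum_conj, isEigenvalue_conj]
  have : FiniteDimensional ℝ ((eigenspace T t).map (J.toLinearEquiv : H →ₗ[ℝ] H)) ↔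
      FiniteDimensional ℝ (eigenspace T t) :=
    Module.Finite.equiv_iff (J.toLinearEquiv.submoduleMap (eigenspace T t)).symm
  rw [eigenspace_conj, this]

/-- The numbers `λ_k` are invariant under conjugation. -/
theorem kthEigenvalue_conj (k : ℕ) :
    kthEigenvalue (J.conjContinuousAlgEquiv T) k = kthEigenvalue T k := by
  have : lambdaInfty (J.conjContinuousAlgEquiv T) = lambdaInfty T := by
    simp only [lambdaInfty, essentialSpectrum, discreteSpectrum_conj, spectrum_conj]
  simp only [kthEigenvalue, this, isEigenvalue_conj, eigenvalueCount_conj]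

end Conjugation

noncomputable section

/-! ### Compactness of integral operators with indicator kernels; multiplication operators. -/

section KernelOperator

variable {X : Type*} [MeasurableSpace X] (μ : Measure X) [IsFiniteMeasure μ]

/-- The integral operator with kernel the indicator of a set, on functions. -/
def kernelFun (S : Set (X × X)) (u : X → ℝ) (x : X) : ℝ := ∫ y in {y | (x, y) ∈ S}, u y ∂μ

omit [IsFiniteMeasure μ] in
lemma kernelFun_eq {S : Set (X × X)} (hS : MeasurableSet S) (u : X → ℝ) (x : X) :
    kernelFun μ S u x = ∫ y, S.indicator (fun p => u p.2) (x, y) ∂μ := by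
  exact (integral_indicator (measurable_prodMk_left hS)).symm

lemma kernelFun_stronglyMeasurable {S : Set (X × X)} (hS : MeasurableSet S) {u : X → ℝ}
    (hu : StronglyMeasurable u) : StronglyMeasurable (kernelFun μ S u) := by
  have : kernelFun μ S u = fun x => ∫ y, S.indicator (fun p => u p.2) (x, y) ∂μ :=
    funext fun x => kernelFun_eq μ hS u x
  rw [this]
  exact StronglyMeasurable.integral_prod_right
    (f := fun x y => S.indicator (fun p => u p.2) (x, y))
    ((hu.comp_measurable measurable_snd).indicator hS)

/-- Cauchy–Schwarz against the indicator of the section. -/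
lemma abs_kernelFun_le {S : Set (X × X)} (hS : MeasurableSet S) (u : Lp ℝ 2 μ) (x : X) :
    |kernelFun μ S u x| ≤ √(μ.real {y | (x, y) ∈ S}) * ‖u‖ := by
  have hm : MeasurableSet {y | (x, y) ∈ S} := measurable_prodMk_left hS
  rw [kernelFun, ← L2.inner_indicatorConstLp_one (𝕜 := ℝ) hm (measure_ne_top μ _)]
  refine (abs_real_inner_le_norm _ _).trans ?_
  rw [norm_indicatorConstLp (by norm_num) (by norm_num), norm_one, one_mul, Real.sqrt_eq_rpow]
  norm_num

lemma kernelFun_memLp {S : Set (X × X)} (hS : MeasurableSet S) (u : Lp ℝ 2 μ) :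
    MemLp (kernelFun μ S u) 2 μ := by
  refine MemLp.of_bound
    (kernelFun_stronglyMeasurable μ hS (Lp.stronglyMeasurable u)).aestronglyMeasurable
    (√(μ.real univ) * ‖u‖) (ae_of_all _ fun x => (abs_kernelFun_le μ hS u x).trans ?_)
  gcongr
  exacts [measure_ne_top _ _, subset_univ _]

omit [IsFiniteMeasure μ] in
lemma kernelFun_congr (S : Set (X × X)) {u v : X → ℝ} (h : u =ᵐ[μ] v) :
    kernelFun μ S u = kernelFun μ S v := by
  funext x
  exact integral_congr_ae (ae_restrict_of_ae h)

omit [IsFiniteMeasure μ] in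
lemma norm_sq_eq_integral (u : Lp ℝ 2 μ) : ‖u‖ ^ 2 = ∫ x, u x ^ 2 ∂μ := by
  rw [← real_inner_self_eq_norm_sq, L2.inner_def]
  simp [sq]

lemma integral_measureReal_section {S : Set (X × X)} (hS : MeasurableSet S) :
    ∫ x, μ.real {y | (x, y) ∈ S} ∂μ = (μ.prod μ).real S := by
  rw [measureReal_def, Measure.prod_apply hS]
  exact integral_toReal (measurable_measure_prodMk_left hS).aemeasurable
    (ae_of_all _ fun x => measure_lt_top _ _)

/-- The Hilbert–Schmidt bound: square the pointwise estimate and integrate the volumes of the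
sections by Fubini. -/
lemma norm_toLp_kernelFun_le {S : Set (X × X)} (hS : MeasurableSet S) (u : Lp ℝ 2 μ) :
    ‖(kernelFun_memLp μ hS u).toLp‖ ≤ √((μ.prod μ).real S) * ‖u‖ := by
  rw [← sq_le_sq₀ (norm_nonneg _) (by positivity), norm_sq_eq_integral, mul_pow,
    Real.sq_sqrt measureReal_nonneg, ← integral_measureReal_section μ hS, ← integral_mul_const]
  refine integral_mono_ae (Lp.memLp _).integrable_sq ?_ ?_
  · refine Integrable.mul_const (Integrable.of_bound
      (measurable_measure_prodMk_left hS).ennreal_toReal.aestronglyMeasurable (μ.real univ)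
      (ae_of_all _ fun x => ?_)) _
    rw [Real.norm_of_nonneg ENNReal.toReal_nonneg]
    exact measureReal_mono (subset_univ _)
  · filter_upwards [(kernelFun_memLp μ hS u).coeFn_toLp] with x hx
    rw [hx, ← sq_abs]
    calc _ ≤ (√(μ.real {y | (x, y) ∈ S}) * ‖u‖) ^ 2 := by
          gcongr; exact abs_kernelFun_le μ hS u x
      _ = _ := by rw [mul_pow, Real.sq_sqrt measureReal_nonneg]

lemma integrable_coeFn (u : Lp ℝ 2 μ) : Integrable u μ := (Lp.memLp u).integrable one_le_two

/-- The integral operator on `L²` with kernel the indicator of a set. -/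
def kernelOp {S : Set (X × X)} (hS : MeasurableSet S) : Lp ℝ 2 μ →L[ℝ] Lp ℝ 2 μ :=
  LinearMap.mkContinuous
    { toFun := fun u => (kernelFun_memLp μ hS u).toLp
      map_add' := fun u v => by
        rw [← MemLp.toLp_add, MemLp.toLp_eq_toLp_iff]
        refine Filter.Eventually.of_forall fun x => ?_
        rw [kernelFun_congr μ S (Lp.coeFn_add u v)]
        exact integral_add (integrable_coeFn μ u).integrableOn (integrable_coeFn μ v).integrableOn
      map_smul' := fun c u => by
        rw [RingHom.id_apply, ← MemLp.toLp_const_smul, MemLp.toLp_eq_toLp_iff]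
        refine Filter.Eventually.of_forall fun x => ?_
        rw [kernelFun_congr μ S (Lp.coeFn_smul c u)]
        exact integral_const_mul c _ }
    _ (norm_toLp_kernelFun_le μ hS)

lemma kernelOp_coeFn {S : Set (X × X)} (hS : MeasurableSet S) (u : Lp ℝ 2 μ) :
    kernelOp μ hS u =ᵐ[μ] kernelFun μ S u :=
  (kernelFun_memLp μ hS u).coeFn_toLp

lemma norm_kernelOp_le {S : Set (X × X)} (hS : MeasurableSet S) :
    ‖kernelOp μ hS‖ ≤ √((μ.prod μ).real S) :=
  LinearMap.mkContinuous_norm_le _ (Real.sqrt_nonneg _) _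

lemma kernelOp_union {S T : Set (X × X)} (hS : MeasurableSet S) (hT : MeasurableSet T)
    (h : Disjoint S T) : kernelOp μ (hS.union hT) = kernelOp μ hS + kernelOp μ hT := by
  ext1 u
  refine Lp.ext ?_
  filter_upwards [kernelOp_coeFn μ (hS.union hT) u, kernelOp_coeFn μ hS u, kernelOp_coeFn μ hT u,
    Lp.coeFn_add (kernelOp μ hS u) (kernelOp μ hT u)] with x h1 h2 h3 h4
  rw [add_apply, h4, Pi.add_apply, h1, h2, h3]
  refine setIntegral_union ?_ (measurable_prodMk_left hT) (integrable_coeFn μ u).integrableOn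
    (integrable_coeFn μ u).integrableOn
  exact Set.disjoint_left.2 fun y hy hy' => Set.disjoint_left.1 h hy hy'

/-- For a rectangle the operator has rank at most one. -/
lemma isCompactOperator_kernelOp_prod {s t : Set X} (hs : MeasurableSet s) (ht : MeasurableSet t) :
    IsCompactOperator (kernelOp μ (hs.prod ht)) := by
  have : kernelOp μ (hs.prod ht) =
      (ContinuousLinearMap.toSpanSingleton ℝ (indicatorConstLp 2 hs (measure_ne_top μ s) (1 : ℝ))) ∘L
        innerSL ℝ (indicatorConstLp 2 ht (measure_ne_top μ t) (1 : ℝ)) := by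
    ext1 u
    refine Lp.ext ?_
    rw [ContinuousLinearMap.comp_apply, ContinuousLinearMap.toSpanSingleton_apply,
      innerSL_apply_apply, L2.inner_indicatorConstLp_one (𝕜 := ℝ) ht (measure_ne_top μ t)]
    filter_upwards [kernelOp_coeFn μ (hs.prod ht) u,
      Lp.coeFn_smul (∫ y in t, u y ∂μ) (indicatorConstLp 2 hs (measure_ne_top μ s) (1 : ℝ)),
      indicatorConstLp_coeFn (p := 2) (hs := hs) (hμs := measure_ne_top μ s) (c := (1 : ℝ))]
      with x h1 h2 h3
    rw [h1, h2, Pi.smul_apply, h3, kernelFun]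
    by_cases hx : x ∈ s <;> simp [hx]
  rw [this]
  exact (isCompactOperator_of_locallyCompactSpace_rng
    (ContinuousLinearMap.toSpanSingleton ℝ
      (indicatorConstLp 2 hs (measure_ne_top μ s) (1 : ℝ)))).comp_clm _

/-- Integral operators with kernel the indicator of a measurable set are compact. -/
theorem isCompactOperator_kernelOp {S : Set (X × X)} (hS : MeasurableSet S) :
    IsCompactOperator (kernelOp μ hS) := by
  -- Induction from rectangles: a complement is a difference from the full square, and a countable
  -- disjoint union is a limit in operator norm of finite unions, by the Hilbert–Schmidt bound on
  -- the remainder.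
  induction S, hS using MeasurableSpace.induction_on_inter generateFrom_prod.symm isPiSystem_prod with
  | empty =>
    have : kernelOp μ (MeasurableSet.empty : MeasurableSet (∅ : Set (X × X))) = 0 := by
      have := norm_kernelOp_le μ (MeasurableSet.empty : MeasurableSet (∅ : Set (X × X)))
      simpa using this
    rw [this]
    exact isCompactOperator_zero
  | basic S hS =>
    obtain ⟨s, hs, t, ht, rfl⟩ := hS
    exact isCompactOperator_kernelOp_prod μ hs ht
  | compl S hS ih =>
    have h1 := kernelOp_union μ hS hS.compl disjoint_compl_right
    have h2 : kernelOp μ hS.compl =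
        kernelOp μ ((MeasurableSet.univ (α := X)).prod (MeasurableSet.univ (α := X))) -
          kernelOp μ hS := by
      have h3 : kernelOp μ (hS.union hS.compl) =
          kernelOp μ ((MeasurableSet.univ (α := X)).prod (MeasurableSet.univ (α := X))) := by
        congr 1
        rw [union_compl_self, univ_prod_univ]
      rw [← h3, h1, add_sub_cancel_left]
    rw [h2]
    exact (isCompactOperator_kernelOp_prod μ MeasurableSet.univ MeasurableSet.univ).sub ih
  | iUnion f hd hf ih =>
    have hfin : ∀ n : ℕ, MeasurableSet (⋃ i ∈ Finset.range n, f i) := fun n =>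
      Finset.measurableSet_biUnion _ fun i _ => hf i
    have hcompact : ∀ n, IsCompactOperator (kernelOp μ (hfin n)) := by
      intro n
      induction n with
      | zero =>
        have : kernelOp μ (hfin 0) = 0 := by
          have := norm_kernelOp_le μ (hfin 0)
          simpa using this
        rw [this]
        exact isCompactOperator_zero
      | succ n ihn =>
        have hdis : Disjoint (⋃ i ∈ Finset.range n, f i) (f n) := by
          simp only [disjoint_iUnion_left, Finset.mem_range]
          exact fun i hi => hd hi.ne
        have : kernelOp μ (hfin (n + 1)) = kernelOp μ (hfin n) + kernelOp μ (hf n) := by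
          rw [← kernelOp_union μ (hfin n) (hf n) hdis]
          congr 1
          rw [Finset.range_add_one, Finset.set_biUnion_insert, union_comm]
        rw [this]
        exact ihn.add (ih n)
    have hU : MeasurableSet (⋃ i, f i) := MeasurableSet.iUnion hf
    have hsub : ∀ n, (⋃ i ∈ Finset.range n, f i) ⊆ ⋃ i, f i := fun n =>
      iUnion₂_subset fun i _ => subset_iUnion f i
    have hnorm : ∀ n, ‖kernelOp μ (hfin n) - kernelOp μ hU‖ ≤
        √((μ.prod μ).real (⋃ i, f i) - (μ.prod μ).real (⋃ i ∈ Finset.range n, f i)) := fun n => by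
      have h1 := kernelOp_union μ (hfin n) (hU.diff (hfin n)) disjoint_sdiff_right
      have h2 : kernelOp μ hU = kernelOp μ ((hfin n).union (hU.diff (hfin n))) := by
        congr 1
        rw [union_sdiff_cancel (hsub n)]
      rw [h2, h1, norm_sub_rev, add_sub_cancel_left, ← measureReal_sdiff (hsub n) (hfin n)]
      exact norm_kernelOp_le μ _
    have hlim : Filter.Tendsto (fun n => kernelOp μ (hfin n)) Filter.atTop
        (nhds (kernelOp μ hU)) := by
      rw [tendsto_iff_norm_sub_tendsto_zero]
      refine squeeze_zero (fun _ => norm_nonneg _) hnorm ?_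
      have hmono : Monotone fun n => ⋃ i ∈ Finset.range n, f i := fun m n hmn =>
        biUnion_subset_biUnion_left (by simpa using hmn)
      have h1 := tendsto_measure_iUnion_atTop (μ := μ.prod μ) hmono
      have h2 : (⋃ n, ⋃ i ∈ Finset.range n, f i) = ⋃ i, f i := by
        refine subset_antisymm (iUnion_subset hsub) (iUnion_subset fun i x hx => ?_)
        exact mem_iUnion.2 ⟨i + 1, mem_iUnion₂.2 ⟨i, by simp, hx⟩⟩
      rw [h2] at h1
      have h3 := (ENNReal.tendsto_toReal (measure_ne_top _ _)).comp h1
      have h4 := (Real.continuous_sqrt.tendsto _).comp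
        (h3.const_sub ((μ.prod μ).real (⋃ i, f i)))
      simpa [measureReal_def, Function.comp_def] using h4
    exact isCompactOperator_of_tendsto hlim (Filter.Eventually.of_forall hcompact)

/-- Multiplication by a bounded function. -/
def mulOp {g : X → ℝ} (hg : MemLp g ∞ μ) : Lp ℝ 2 μ →L[ℝ] Lp ℝ 2 μ :=
  (ContinuousLinearMap.mul ℝ ℝ).holderL μ ∞ 2 2 (hg.toLp g)

omit [IsFiniteMeasure μ] in
lemma mulOp_coeFn {g : X → ℝ} (hg : MemLp g ∞ μ) (u : Lp ℝ 2 μ) :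
    mulOp μ hg u =ᵐ[μ] fun x => g x * u x := by
  filter_upwards [(ContinuousLinearMap.mul ℝ ℝ).coeFn_holder (r := 2) (hg.toLp g) u,
    hg.coeFn_toLp] with x h1 h2
  rw [← h2]
  exact h1

omit [IsFiniteMeasure μ] in
lemma inner_mulOp_left {g : X → ℝ} (hg : MemLp g ∞ μ) (u v : Lp ℝ 2 μ) :
    inner ℝ (mulOp μ hg u) v = inner ℝ u (mulOp μ hg v) := by
  rw [L2.inner_def, L2.inner_def]
  refine integral_congr_ae ?_
  filter_upwards [mulOp_coeFn μ hg u, mulOp_coeFn μ hg v] with x h1 h2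
  simp only [h1, h2, RCLike.inner_apply, conj_trivial]
  ring

omit [IsFiniteMeasure μ] in
lemma mulOp_mulOp_of_mul_eq_one {g h : X → ℝ} (hg : MemLp g ∞ μ) (hh : MemLp h ∞ μ)
    (hgh : ∀ᵐ x ∂μ, g x * h x = 1) (u : Lp ℝ 2 μ) : mulOp μ hg (mulOp μ hh u) = u := by
  refine Lp.ext ?_
  filter_upwards [mulOp_coeFn μ hg (mulOp μ hh u), mulOp_coeFn μ hh u, hgh] with x h1 h2 h3
  rw [h1, h2, ← mul_assoc, h3, one_mul]

end KernelOperator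

/-! ### The `ρ`-Laplacian as a conjugate of `ρ⁻²(1 - B)`. -/

section Laplacian

variable {X : Type*} [PseudoMetricSpace X] [MeasurableSpace X]

/-- The squared norm of the scalar product for which the `ρ`-Laplacian is symmetric. -/
def weightForm (μ : Measure X) (ρ : ℝ) (u : X → ℝ) : ℝ := ∫ x, μ.real (ball x ρ) * u x ^ 2 ∂μ

/-- The quadratic form of the averaging operator. -/
def avgForm (μ : Measure X) (ρ : ℝ) (u : X → ℝ) : ℝ := ∫ x, (∫ y in ball x ρ, u y ∂μ) * u x ∂μ

variable [CompactSpace X] [BorelSpace X] (μ : Measure X) [IsFiniteMeasure μ] {ρ : ℝ}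

variable (X ρ) in
lemma measurableSet_dist_lt : MeasurableSet {p : X × X | dist p.2 p.1 < ρ} :=
  (isOpen_lt (by fun_prop) continuous_const).measurableSet

lemma measurable_measureReal_ball (ρ : ℝ) : Measurable fun x => μ.real (ball x ρ) :=
  (measurable_measure_prodMk_left (ν := μ) (measurableSet_dist_lt X ρ)).ennreal_toReal

lemma memLp_sqrt_measureReal_ball (ρ : ℝ) : MemLp (fun x => √(μ.real (ball x ρ))) ∞ μ := by
  refine memLp_top_of_bound (measurable_measureReal_ball μ ρ).sqrt.aestronglyMeasurable
    (√(μ.real univ)) (ae_of_all _ fun x => ?_)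
  rw [Real.norm_of_nonneg (Real.sqrt_nonneg _)]
  exact Real.sqrt_le_sqrt (measureReal_mono (subset_univ _))

lemma memLp_inv_sqrt_measureReal_ball (hρ : 0 < ρ) :
    MemLp (fun x => (√(μ.real (ball x ρ)))⁻¹) ∞ μ := by
  obtain ⟨c, hc, hcx⟩ := exists_ball_lower_bound μ hρ
  refine memLp_top_of_bound (measurable_measureReal_ball μ ρ).sqrt.inv.aestronglyMeasurable
    (√c)⁻¹ ?_
  filter_upwards [Measure.support_mem_ae (μ := μ)] with x hx
  rw [Real.norm_of_nonneg (by positivity)]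
  have := Real.sqrt_pos.2 hc
  gcongr
  exact hcx x hx

lemma ae_measureReal_ball_pos (hρ : 0 < ρ) : ∀ᵐ x ∂μ, 0 < μ.real (ball x ρ) := by
  obtain ⟨c, hc, hcx⟩ := exists_ball_lower_bound μ hρ
  filter_upwards [Measure.support_mem_ae (μ := μ)] with x hx
  exact hc.trans_le (hcx x hx)

/-- Multiplication by the square root of the volume of the balls. -/
def sqrtWeightEquiv (hρ : 0 < ρ) : Lp ℝ 2 μ ≃L[ℝ] Lp ℝ 2 μ :=
  ContinuousLinearEquiv.equivOfInverse (mulOp μ (memLp_sqrt_measureReal_ball μ ρ))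
    (mulOp μ (memLp_inv_sqrt_measureReal_ball μ hρ))
    (mulOp_mulOp_of_mul_eq_one μ _ _ (by
      filter_upwards [ae_measureReal_ball_pos μ hρ] with x hx
      exact inv_mul_cancel₀ (Real.sqrt_pos.2 hx).ne'))
    (mulOp_mulOp_of_mul_eq_one μ _ _ (by
      filter_upwards [ae_measureReal_ball_pos μ hρ] with x hx
      exact mul_inv_cancel₀ (Real.sqrt_pos.2 hx).ne'))

/-- The symmetrized averaging operator. -/
def symmAvgOp (hρ : 0 < ρ) : Lp ℝ 2 μ →L[ℝ] Lp ℝ 2 μ :=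
  mulOp μ (memLp_inv_sqrt_measureReal_ball μ hρ) ∘L kernelOp μ (measurableSet_dist_lt X ρ) ∘L
    mulOp μ (memLp_inv_sqrt_measureReal_ball μ hρ)

lemma isCompactOperator_symmAvgOp (hρ : 0 < ρ) : IsCompactOperator (symmAvgOp μ hρ) :=
  ((isCompactOperator_kernelOp μ (measurableSet_dist_lt X ρ)).comp_clm
    (mulOp μ (memLp_inv_sqrt_measureReal_ball μ hρ))).clm_comp
      (mulOp μ (memLp_inv_sqrt_measureReal_ball μ hρ))

/-- With `m` the volume of the balls and `K` the integral operator over them, the Laplacian is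
`ρ⁻²(1 - m⁻¹K)`, and conjugating `m⁻¹K` by `√m` gives `m^{-1/2} K m^{-1/2}`. -/
lemma conj_rhoLaplacian (hρ : 0 < ρ) :
    (sqrtWeightEquiv μ hρ).conjContinuousAlgEquiv (rhoLaplacian μ ρ) =
      (ρ ^ 2)⁻¹ • (1 - symmAvgOp μ hρ) := by
  ext1 u
  refine Lp.ext ?_
  set M := mulOp μ (memLp_inv_sqrt_measureReal_ball μ hρ)
  set K := kernelOp μ (measurableSet_dist_lt X ρ)
  set N := mulOp μ (memLp_sqrt_measureReal_ball μ ρ)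
  change N (rhoLaplacian μ ρ (M u)) =ᵐ[μ] ((ρ ^ 2)⁻¹ • (u - M (K (M u))) : Lp ℝ 2 μ)
  filter_upwards [mulOp_coeFn μ (memLp_sqrt_measureReal_ball μ ρ) (rhoLaplacian μ ρ (M u)),
    mulOp_coeFn μ (memLp_inv_sqrt_measureReal_ball μ hρ) u,
    mulOp_coeFn μ (memLp_inv_sqrt_measureReal_ball μ hρ) (K (M u)),
    kernelOp_coeFn μ (measurableSet_dist_lt X ρ) (M u), rhoLaplacian_coeFn μ ρ (M u),
    ae_measureReal_ball_pos μ hρ, Lp.coeFn_smul (ρ ^ 2)⁻¹ (u - M (K (M u))),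
    Lp.coeFn_sub u (M (K (M u)))] with x h1 h2 h3 h4 h5 h6 h7 h8
  rw [h1, h5, h7, Pi.smul_apply, h8, Pi.sub_apply, h3, h4, rhoLaplacianFun,
    integral_sub (integrable_const _) (integrable_coeFn μ _).integrableOn]
  change √(μ.real (ball x ρ)) * (1 / (ρ ^ 2 * μ.real (ball x ρ)) *
    (∫ _ in ball x ρ, M u x ∂μ - kernelFun μ {p : X × X | dist p.2 p.1 < ρ} (M u) x)) = _
  rw [h2, setIntegral_const, smul_eq_mul, smul_eq_mul]
  have hs : 0 < √(μ.real (ball x ρ)) := Real.sqrt_pos.2 h6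
  have hm : μ.real (ball x ρ) = √(μ.real (ball x ρ)) ^ 2 := (Real.sq_sqrt h6.le).symm
  set s := √(μ.real (ball x ρ))
  rw [hm]
  field_simp

lemma norm_sq_sqrtWeightEquiv (hρ : 0 < ρ) (u : Lp ℝ 2 μ) :
    ‖sqrtWeightEquiv μ hρ u‖ ^ 2 = weightForm μ ρ u := by
  rw [norm_sq_eq_integral]
  refine integral_congr_ae ?_
  filter_upwards [mulOp_coeFn μ (memLp_sqrt_measureReal_ball μ ρ) u] with x h
  change (mulOp μ (memLp_sqrt_measureReal_ball μ ρ) u x) ^ 2 = _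
  rw [h, mul_pow, Real.sq_sqrt measureReal_nonneg]

lemma inner_kernelOp_self (u : Lp ℝ 2 μ) :
    inner ℝ (kernelOp μ (measurableSet_dist_lt X ρ) u) u = avgForm μ ρ u := by
  rw [L2.inner_def]
  refine integral_congr_ae ?_
  filter_upwards [kernelOp_coeFn μ (measurableSet_dist_lt X ρ) u] with x h
  rw [h]
  simp only [RCLike.inner_apply, conj_trivial]
  exact mul_comm _ _

lemma inner_symmAvgOp_sqrtWeightEquiv (hρ : 0 < ρ) (u : Lp ℝ 2 μ) :
    inner ℝ (symmAvgOp μ hρ (sqrtWeightEquiv μ hρ u)) (sqrtWeightEquiv μ hρ u) =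
      avgForm μ ρ u := by
  have h : mulOp μ (memLp_inv_sqrt_measureReal_ball μ hρ) (sqrtWeightEquiv μ hρ u) = u :=
    (sqrtWeightEquiv μ hρ).symm_apply_apply u
  rw [symmAvgOp, ContinuousLinearMap.comp_apply, ContinuousLinearMap.comp_apply, inner_mulOp_left,
    h, inner_kernelOp_self]

/-- Fubini and the symmetry of the distance. -/
lemma inner_kernelOp_comm (u v : Lp ℝ 2 μ) :
    inner ℝ (kernelOp μ (measurableSet_dist_lt X ρ) u) v =
      inner ℝ u (kernelOp μ (measurableSet_dist_lt X ρ) v) := by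
  have hS := measurableSet_dist_lt X ρ
  set S := {p : X × X | dist p.2 p.1 < ρ}
  have key : ∀ f g : Lp ℝ 2 μ, inner ℝ f (kernelOp μ hS g) =
      ∫ x, ∫ y, S.indicator (fun p => f p.1 * g p.2) (x, y) ∂μ ∂μ := fun f g => by
    rw [L2.inner_def]
    refine integral_congr_ae ?_
    filter_upwards [kernelOp_coeFn μ hS g] with x hx
    rw [hx, kernelFun_eq μ hS]
    simp only [RCLike.inner_apply, conj_trivial]
    rw [mul_comm, ← integral_const_mul]
    congr 1
    funext y
    by_cases h : (x, y) ∈ S <;> simp [h]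
  rw [real_inner_comm, key, key, integral_integral_swap]
  · congr 1; funext x; congr 1; funext y
    have : (y, x) ∈ S ↔ (x, y) ∈ S := by simp [S, dist_comm]
    by_cases h : (x, y) ∈ S
    · simp [h, this.2 h, mul_comm]
    · simp [h, mt this.1 h]
  · exact ((integrable_coeFn μ v).mul_prod (integrable_coeFn μ u)).indicator hS

lemma isSymmetric_symmAvgOp (hρ : 0 < ρ) : (symmAvgOp μ hρ).IsSymmetric := fun u v => by
  change inner ℝ (symmAvgOp μ hρ u) v = inner ℝ u (symmAvgOp μ hρ v)
  simp only [symmAvgOp, ContinuousLinearMap.comp_apply]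
  rw [inner_mulOp_left, inner_kernelOp_comm, inner_mulOp_left]

lemma div_inv_sq (s : ℝ) : 1 - s / (ρ ^ 2)⁻¹ = 1 - s * ρ ^ 2 := by rw [div_inv_eq_mul]

/-- Upper bounds on `λ_k` give `k`-dimensional spaces with small Rayleigh quotients. -/
theorem exists_submodule_of_lambda_lt (hρ : 0 < ρ) {k : ℕ} {s : ℝ} (hs : s ≤ (ρ ^ 2)⁻¹)
    (hk : lambda μ ρ k < s) :
    ∃ V : Submodule ℝ (Lp ℝ 2 μ), Module.finrank ℝ V = k ∧
      ∀ u ∈ V, (1 - s * ρ ^ 2) * weightForm μ ρ u ≤ avgForm μ ρ u := by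
  rw [lambda, ← kthEigenvalue_conj (sqrtWeightEquiv μ hρ), conj_rhoLaplacian] at hk
  obtain ⟨V, hV, -, hVf⟩ := exists_submodule_of_kthEigenvalue_lt (by positivity)
    (isSymmetric_symmAvgOp μ hρ) (isCompactOperator_symmAvgOp μ hρ) hs hk
  refine ⟨V.map ((sqrtWeightEquiv μ hρ).symm.toLinearEquiv : Lp ℝ 2 μ →ₗ[ℝ] Lp ℝ 2 μ), ?_, ?_⟩
  · rw [← hV]
    exact LinearEquiv.finrank_map_eq _ _
  · rintro _ ⟨w, hw, rfl⟩
    change _ * weightForm μ ρ ((sqrtWeightEquiv μ hρ).symm w) ≤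
      avgForm μ ρ ((sqrtWeightEquiv μ hρ).symm w)
    rw [← norm_sq_sqrtWeightEquiv μ hρ, ← inner_symmAvgOp_sqrtWeightEquiv μ hρ,
      ContinuousLinearEquiv.apply_symm_apply, ← div_inv_sq]
    exact hVf w hw

/-- Spaces of dimension `k` with small Rayleigh quotients give upper bounds on `λ_k`. -/
theorem lambda_le_of_submodule (hρ : 0 < ρ) {k : ℕ} (hk : 1 ≤ k) {s : ℝ} (hs : s < (ρ ^ 2)⁻¹)
    {V : Submodule ℝ (Lp ℝ 2 μ)} (hV : Module.finrank ℝ V = k)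
    (hVf : ∀ u ∈ V, (1 - s * ρ ^ 2) * weightForm μ ρ u ≤ avgForm μ ρ u) :
    lambda μ ρ k ≤ s := by
  rw [lambda, ← kthEigenvalue_conj (sqrtWeightEquiv μ hρ), conj_rhoLaplacian]
  refine kthEigenvalue_le_of_submodule (by positivity) (isSymmetric_symmAvgOp μ hρ)
    (isCompactOperator_symmAvgOp μ hρ) hk hs
    (V := V.map ((sqrtWeightEquiv μ hρ).toLinearEquiv : Lp ℝ 2 μ →ₗ[ℝ] Lp ℝ 2 μ)) ?_ ?_
  · rw [← hV]
    exact LinearEquiv.finrank_map_eq _ _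
  · rintro _ ⟨w, hw, rfl⟩
    change _ * ‖sqrtWeightEquiv μ hρ w‖ ^ 2 ≤ inner ℝ (symmAvgOp μ hρ (sqrtWeightEquiv μ hρ w))
      (sqrtWeightEquiv μ hρ w)
    rw [norm_sq_sqrtWeightEquiv μ hρ, inner_symmAvgOp_sqrtWeightEquiv μ hρ, div_inv_sq]
    exact hVf w hw

end Laplacian

end

/-! ### Couplings of close spaces by a marriage theorem. -/

section Coupling

/-- An inequality between the measures of superlevel sets integrates. -/
lemma integral_le_mul_integral_of_superlevel {α β : Type*} [MeasurableSpace α] [MeasurableSpace β]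
    {μ : Measure α} {ν : Measure β} {u : α → ℝ} {v : β → ℝ} (hu : Integrable u μ)
    (hv : Integrable v ν) (hu0 : 0 ≤ u) (hv0 : 0 ≤ v) {c : ℝ} (hc : 0 ≤ c)
    (h : ∀ t, 0 < t → μ {x | t ≤ u x} ≤ ENNReal.ofReal c * ν {y | t ≤ v y}) :
    ∫ x, u x ∂μ ≤ c * ∫ y, v y ∂ν := by
  have hv' : 0 ≤ ∫ y, v y ∂ν := integral_nonneg hv0
  rw [← ENNReal.ofReal_le_ofReal_iff (mul_nonneg hc hv'), ENNReal.ofReal_mul hc,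
    ofReal_integral_eq_lintegral_ofReal hu (ae_of_all _ hu0),
    ofReal_integral_eq_lintegral_ofReal hv (ae_of_all _ hv0),
    lintegral_eq_lintegral_meas_le μ (ae_of_all _ hu0) hu.aemeasurable,
    lintegral_eq_lintegral_meas_le ν (ae_of_all _ hv0) hv.aemeasurable,
    ← lintegral_const_mul' _ _ ENNReal.ofReal_ne_top]
  exact setLIntegral_mono' measurableSet_Ioi fun t ht => h t ht

/-- Finite measures on a compact metric space are compared by the integrals of continuous
functions. -/
lemma measure_le_of_integral_le {X : Type*} [MetricSpace X] [CompactSpace X] [MeasurableSpace X]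
    [BorelSpace X] {μ ν : Measure X} [IsFiniteMeasure μ] [IsFiniteMeasure ν]
    (h : ∀ f : C(X, ℝ), 0 ≤ f → ∫ x, f x ∂μ ≤ ∫ x, f x ∂ν) : μ ≤ ν := by
  have hint : ∀ (f : C(X, ℝ)) (m : Measure X) [IsFiniteMeasure m], Integrable f m := fun f m _ =>
    f.continuous.integrable_of_hasCompactSupport (HasCompactSupport.of_compactSpace _)
  -- Closed sets are handled by Urysohn functions and outer regularity of `ν`; general Borel sets
  -- then follow from inner regularity of `μ`.
  have hclosed : ∀ F : Set X, IsClosed F → μ F ≤ ν F := by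
    intro F hF
    refine ENNReal.le_of_forall_pos_le_add fun ε hε _ => ?_
    obtain ⟨V, hFV, hV, hVε⟩ := F.exists_isOpen_le_add ν (ne_of_gt (ENNReal.coe_lt_coe.mpr hε))
    refine le_trans ?_ hVε
    obtain ⟨f, hf1, hf2, hf3⟩ :=
      exists_continuousMap_one_of_isCompact_subset_isOpen hF.isCompact hV hFV
    have h1 : μ.real F ≤ ∫ x, f x ∂μ := by
      rw [← integral_indicator_one hF.measurableSet]
      refine integral_mono ((integrable_const 1).indicator hF.measurableSet) (hint f μ) fun x => ?_
      by_cases hx : x ∈ F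
      · simp [hx, hf1 hx]
      · simpa [hx] using (hf3.2 x).1
    have h2 : ∫ x, f x ∂ν ≤ ν.real V := by
      rw [← integral_indicator_one hV.measurableSet]
      refine integral_mono (hint f ν) ((integrable_const 1).indicator hV.measurableSet) fun x => ?_
      by_cases hx : x ∈ V
      · simpa [hx] using (hf3.2 x).2
      · have : x ∉ tsupport f := fun hx' => hx (hf3.1 hx')
        simp [hx, image_eq_zero_of_notMem_tsupport this]
    have h3 := (h1.trans (h f fun x => (hf3.2 x).1)).trans h2
    exact (ENNReal.toReal_le_toReal (measure_ne_top _ _) (measure_ne_top _ _)).1 h3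
  refine Measure.le_iff.2 fun A hA => ?_
  rw [hA.measure_eq_iSup_isClosed_of_ne_top (measure_ne_top μ A)]
  exact iSup₂_le fun F hF => iSup_le fun hFc => (hclosed F hFc).trans (measure_mono hF)

variable {X Y : Type*} [MetricSpace X] [CompactSpace X] [MeasurableSpace X] [BorelSpace X]
  [MetricSpace Y] [CompactSpace Y] [MeasurableSpace Y] [BorelSpace Y]
  {μX : Measure X} [IsFiniteMeasure μX] {μY : Measure Y} [IsFiniteMeasure μY]

lemma integrable_of_continuous {f : X → ℝ} (hf : Continuous f) : Integrable f μX :=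
  hf.integrable_of_hasCompactSupport (HasCompactSupport.of_compactSpace _)

/-- The duality inequality behind the existence of couplings. -/
lemma integral_max_add_integral_nonneg {R : Set (X × Y)} {c : ℝ} (hc : 1 ≤ c)
    (hX : ∀ A : Set X, IsClosed A →
      μX A ≤ ENNReal.ofReal c * μY (Prod.snd '' (R ∩ Prod.fst ⁻¹' A)))
    (hY : ∀ A : Set Y, IsClosed A →
      μY A ≤ ENNReal.ofReal c * μX (Prod.fst '' (R ∩ Prod.snd ⁻¹' A)))
    {f : X → ℝ} (hf : Continuous f) {g : Y → ℝ} (hg : Continuous g)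
    (hfg : ∀ p ∈ R, 0 ≤ f p.1 + g p.2) :
    0 ≤ ∫ x, max (c * f x) (c⁻¹ * f x) ∂μX + ∫ y, g y ∂μY := by
  have hc0 : 0 < c := one_pos.trans_le hc
  have hfp : Integrable (fun x => max (f x) 0) μX :=
    integrable_of_continuous (hf.max continuous_const)
  have hfn : Integrable (fun x => max (-f x) 0) μX :=
    integrable_of_continuous (hf.neg.max continuous_const)
  have hgp : Integrable (fun y => max (g y) 0) μY :=
    integrable_of_continuous (hg.max continuous_const)
  have hgn : Integrable (fun y => max (-g y) 0) μY :=
    integrable_of_continuous (hg.neg.max continuous_const)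
  -- On `R`, `g ≤ -t` forces `f ≥ t`. The marriage condition therefore compares superlevel sets of
  -- the negative part of `g` with those of the positive part of `f`; `h2` is the same with the
  -- roles exchanged.
  have h1 : ∫ y, max (-g y) 0 ∂μY ≤ c * ∫ x, max (f x) 0 ∂μX := by
    refine integral_le_mul_integral_of_superlevel hgn hfp (fun _ => le_max_right _ _)
      (fun _ => le_max_right _ _) hc0.le fun t ht => ?_
    refine (hY _ (isClosed_le continuous_const (hg.neg.max continuous_const))).trans ?_
    gcongr
    rintro _ ⟨p, ⟨hpR, hp⟩, rfl⟩
    have h2 : t ≤ max (-g p.2) 0 := hp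
    have h3 := hfg p hpR
    rcases le_max_iff.1 h2 with h4 | h4
    · have h5 : t ≤ f p.1 := by linarith
      exact le_max_of_le_left h5
    · linarith
  have h2 : ∫ x, max (-f x) 0 ∂μX ≤ c * ∫ y, max (g y) 0 ∂μY := by
    refine integral_le_mul_integral_of_superlevel hfn hgp (fun _ => le_max_right _ _)
      (fun _ => le_max_right _ _) hc0.le fun t ht => ?_
    refine (hX _ (isClosed_le continuous_const (hf.neg.max continuous_const))).trans ?_
    gcongr
    rintro _ ⟨p, ⟨hpR, hp⟩, rfl⟩
    have h2 : t ≤ max (-f p.1) 0 := hp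
    have h3 := hfg p hpR
    rcases le_max_iff.1 h2 with h4 | h4
    · have h5 : t ≤ g p.2 := by linarith
      exact le_max_of_le_left h5
    · linarith
  have hcc : c⁻¹ ≤ c := (inv_le_one_of_one_le₀ hc).trans hc
  -- The integrand is `c f⁺ - c⁻¹ f⁻`. Its integral is the largest value of `∫ f dν` over measures
  -- `ν` between `c⁻¹ μX` and `c μX`, which is how the tolerance in the first marginal enters the
  -- duality.
  have h3 : ∫ x, max (c * f x) (c⁻¹ * f x) ∂μX =
      c * ∫ x, max (f x) 0 ∂μX - c⁻¹ * ∫ x, max (-f x) 0 ∂μX := by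
    rw [← integral_const_mul, ← integral_const_mul,
      ← integral_sub (hfp.const_mul c) (hfn.const_mul c⁻¹)]
    congr 1
    funext x
    rcases le_total 0 (f x) with h | h
    · rw [max_eq_left h, max_eq_right (neg_nonpos.2 h), max_eq_left (by gcongr)]
      ring
    · rw [max_eq_right h, max_eq_left (neg_nonneg.2 h),
        max_eq_right (mul_le_mul_of_nonpos_right hcc h)]
      ring
  have h4 : ∫ y, g y ∂μY = ∫ y, max (g y) 0 ∂μY - ∫ y, max (-g y) 0 ∂μY := by
    rw [← integral_sub hgp hgn]
    congr 1
    funext y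
    rcases le_total 0 (g y) with h | h
    · rw [max_eq_left h, max_eq_right (neg_nonpos.2 h), sub_zero]
    · rw [max_eq_right h, max_eq_left (neg_nonneg.2 h)]
      ring
  have h5 : c⁻¹ * ∫ x, max (-f x) 0 ∂μX ≤ ∫ y, max (g y) 0 ∂μY := by
    rwa [inv_mul_le_iff₀ hc0]
  rw [h3, h4]
  linarith

/-- A positive functional on the continuous functions on a compact relation that satisfies
prescribed bounds on the functions of one variable. -/
lemma exists_linearMap_of_relation {R : Set (X × Y)} [CompactSpace R] {c : ℝ} (hc : 1 ≤ c)
    (hX : ∀ A : Set X, IsClosed A →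
      μX A ≤ ENNReal.ofReal c * μY (Prod.snd '' (R ∩ Prod.fst ⁻¹' A)))
    (hY : ∀ A : Set Y, IsClosed A →
      μY A ≤ ENNReal.ofReal c * μX (Prod.fst '' (R ∩ Prod.snd ⁻¹' A))) :
    ∃ L : C(R, ℝ) →ₗ[ℝ] ℝ, ∀ (h : C(R, ℝ)) (f : C(X, ℝ)) (g : C(Y, ℝ)),
      (∀ p : R, h p ≤ f p.1.1 + g p.1.2) →
        L h ≤ ∫ x, max (c * f x) (c⁻¹ * f x) ∂μX + ∫ y, g y ∂μY := by
  have hc0 : 0 < c := one_pos.trans_le hc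
  have hint : ∀ f : C(X, ℝ), Integrable (fun x => max (c * f x) (c⁻¹ * f x)) μX := fun f =>
    integrable_of_continuous (by fun_prop)
  have hintg : ∀ g : C(Y, ℝ), Integrable g μY := fun g => integrable_of_continuous g.continuous
  -- The cone consists of the pairs `(h, t)` where `t` is at least the cost of some `f ⊕ g`
  -- dominating `h`. The functional `(0, t) ↦ t` is non-negative on it by the duality inequality,
  -- and it extends by the M. Riesz theorem; dominating `h` by the constant `‖h‖` gives the second
  -- hypothesis of that theorem.
  let s : PointedCone ℝ (C(R, ℝ) × ℝ) :=
    { carrier := {q | ∃ (f : C(X, ℝ)) (g : C(Y, ℝ)), (∀ p : R, q.1 p ≤ f p.1.1 + g p.1.2) ∧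
        ∫ x, max (c * f x) (c⁻¹ * f x) ∂μX + ∫ y, g y ∂μY ≤ q.2}
      zero_mem' := ⟨0, 0, by simp, by simp⟩
      add_mem' := by
        rintro ⟨h, t⟩ ⟨h', t'⟩ ⟨f, g, h1, h2⟩ ⟨f', g', h1', h2'⟩
        refine ⟨f + f', g + g', fun p => ?_, ?_⟩
        · have := h1 p
          have := h1' p
          simp only [Prod.mk_add_mk, ContinuousMap.add_apply] at *
          linarith
        · have h3 : ∫ x, max (c * (f + f') x) (c⁻¹ * (f + f') x) ∂μX ≤
              ∫ x, max (c * f x) (c⁻¹ * f x) ∂μX + ∫ x, max (c * f' x) (c⁻¹ * f' x) ∂μX := by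
            rw [← integral_add (hint f) (hint f')]
            refine integral_mono (hint _) ((hint f).add (hint f')) fun x => ?_
            simp only [ContinuousMap.add_apply, mul_add]
            exact max_le (add_le_add (le_max_left _ _) (le_max_left _ _))
              (add_le_add (le_max_right _ _) (le_max_right _ _))
          have h4 : ∫ y, (g + g') y ∂μY = ∫ y, g y ∂μY + ∫ y, g' y ∂μY :=
            integral_add (hintg g) (hintg g')
          simp only [Prod.mk_add_mk] at *
          linarith
      smul_mem' := by
        rintro ⟨a, ha⟩ ⟨h, t⟩ ⟨f, g, h1, h2⟩
        refine ⟨a • f, a • g, fun p => ?_, ?_⟩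
        · have := mul_le_mul_of_nonneg_left (h1 p) ha
          rw [mul_add] at this
          exact this
        · have h3 : ∫ x, max (c * (a • f) x) (c⁻¹ * (a • f) x) ∂μX =
              a * ∫ x, max (c * f x) (c⁻¹ * f x) ∂μX := by
            rw [← integral_const_mul]
            congr 1
            funext x
            simp only [ContinuousMap.smul_apply, smul_eq_mul]
            rw [mul_max_of_nonneg _ _ ha, mul_left_comm, mul_left_comm c⁻¹]
          have h4 : ∫ y, (a • g) y ∂μY = a * ∫ y, g y ∂μY := integral_const_mul a _
          rw [h3, h4, ← mul_add]
          exact mul_le_mul_of_nonneg_left h2 ha }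
  let φ : (C(R, ℝ) × ℝ) →ₗ.[ℝ] ℝ :=
    ⟨LinearMap.ker (LinearMap.fst ℝ C(R, ℝ) ℝ), (LinearMap.snd ℝ C(R, ℝ) ℝ).domRestrict _⟩
  obtain ⟨G, hG, hGs⟩ := riesz_extension s φ
    (by
      rintro ⟨⟨h, t⟩, hh⟩ ⟨f, g, h1, h2⟩
      have hh : h = 0 := hh
      subst hh
      refine le_trans ?_ h2
      exact integral_max_add_integral_nonneg hc hX hY f.continuous g.continuous
        fun p hp => h1 ⟨p, hp⟩)
    (by
      rintro ⟨h, t⟩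
      refine ⟨⟨(0, ∫ x, max (c * ‖h‖) (c⁻¹ * ‖h‖) ∂μX + ∫ y, (0 : ℝ) ∂μY - t), rfl⟩,
        ContinuousMap.const X ‖h‖, 0, fun p => ?_, ?_⟩
      · simpa using (le_abs_self _).trans (h.norm_coe_le_norm p)
      · simp)
  refine ⟨-(G ∘ₗ LinearMap.inl ℝ C(R, ℝ) ℝ), fun h f g hfg => ?_⟩
  set t := ∫ x, max (c * f x) (c⁻¹ * f x) ∂μX + ∫ y, g y ∂μY
  have h1 : 0 ≤ G (h, t) := hGs _ ⟨f, g, hfg, le_rfl⟩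
  have h2 : G (h, t) = G (h, 0) + t := by
    have h3 : G (0, t) = t := hG ⟨(0, t), rfl⟩
    rw [← h3, ← map_add]
    simp [h3]
  simp only [LinearMap.neg_apply, LinearMap.comp_apply, LinearMap.inl_apply]
  linarith

/-- A Strassen type theorem: a closed relation that satisfies the marriage condition up to the
factor `c` supports a coupling of `μY` with a measure comparable to `μX`. -/
theorem exists_coupling {R : Set (X × Y)} (hR : IsClosed R) {c : ℝ} (hc : 1 ≤ c)
    (hX : ∀ A : Set X, IsClosed A →
      μX A ≤ ENNReal.ofReal c * μY (Prod.snd '' (R ∩ Prod.fst ⁻¹' A)))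
    (hY : ∀ A : Set Y, IsClosed A →
      μY A ≤ ENNReal.ofReal c * μX (Prod.fst '' (R ∩ Prod.snd ⁻¹' A))) :
    ∃ γ : Measure (X × Y), IsFiniteMeasure γ ∧ (∀ᵐ p ∂γ, p ∈ R) ∧
      MeasurePreserving Prod.snd γ μY ∧ γ.map Prod.fst ≤ ENNReal.ofReal c • μX ∧
      μX ≤ ENNReal.ofReal c • γ.map Prod.fst := by
  have hc0 : 0 < c := one_pos.trans_le hc
  have hcc : c⁻¹ ≤ c := (inv_le_one_of_one_le₀ hc).trans hc
  have : CompactSpace R := isCompact_iff_compactSpace.1 hR.isCompact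
  obtain ⟨L, hL⟩ := exists_linearMap_of_relation hc hX hY
  let toC : CompactlySupportedContinuousMap R ℝ →ₗ[ℝ] C(R, ℝ) :=
    { toFun := fun f => f.toContinuousMap
      map_add' := fun _ _ => rfl
      map_smul' := fun _ _ => rfl }
  -- Positivity: if `f ≥ 0`, then `-f` is dominated by `0`, whose cost is `0`.
  let Λ : CompactlySupportedContinuousMap R ℝ →ₚ[ℝ] ℝ :=
    PositiveLinearMap.mk₀ (L ∘ₗ toC) fun f hf => by
      have h := hL (-toC f) 0 0 fun p => by
        have : 0 ≤ toC f p := hf p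
        simpa using this
      simpa using h
  let m : Measure R := RealRMK.rieszMeasure Λ
  have hm : ∀ h : C(R, ℝ), ∫ p, h p ∂m = L h := fun h =>
    RealRMK.integral_rieszMeasure Λ (CompactlySupportedContinuousMap.continuousMapEquiv h)
  have : IsFiniteMeasure m := ⟨isCompact_univ.measure_lt_top⟩
  let γ : Measure (X × Y) := m.map Subtype.val
  have : IsFiniteMeasure γ := inferInstance
  have hfst : ∀ f : C(X, ℝ), ∫ x, f x ∂(γ.map Prod.fst) =
      L (f.comp ⟨fun p : R => p.1.1, by fun_prop⟩) := fun f => by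
    rw [integral_map measurable_fst.aemeasurable f.continuous.aestronglyMeasurable, ← hm]
    exact integral_map (f := fun p : X × Y => f p.1) measurable_subtype_coe.aemeasurable
      (f.continuous.comp continuous_fst).aestronglyMeasurable
  have hsnd : ∀ g : C(Y, ℝ), ∫ y, g y ∂(γ.map Prod.snd) =
      L (g.comp ⟨fun p : R => p.1.2, by fun_prop⟩) := fun g => by
    rw [integral_map measurable_snd.aemeasurable g.continuous.aestronglyMeasurable, ← hm]
    exact integral_map (f := fun p : X × Y => g p.2) measurable_subtype_coe.aemeasurable
      (g.continuous.comp continuous_snd).aestronglyMeasurable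
  have hle : ∀ g : C(Y, ℝ), ∫ y, g y ∂(γ.map Prod.snd) ≤ ∫ y, g y ∂μY := fun g => by
    rw [hsnd]
    simpa using hL (g.comp ⟨fun p : R => p.1.2, by fun_prop⟩) 0 g fun p => by simp
  have hsmul : ∀ (m : Measure X) (f : C(X, ℝ)), ∫ x, f x ∂(ENNReal.ofReal c • m) =
      c * ∫ x, f x ∂m := fun m f => by
    rw [integral_smul_measure, ENNReal.toReal_ofReal hc0.le, smul_eq_mul]
  have hfinX : IsFiniteMeasure (ENNReal.ofReal c • μX) :=
    Measure.smul_finite μX ENNReal.ofReal_ne_top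
  have hfinγ : IsFiniteMeasure (ENNReal.ofReal c • γ.map Prod.fst) :=
    Measure.smul_finite _ ENNReal.ofReal_ne_top
  refine ⟨γ, inferInstance, ?_, ⟨measurable_snd, le_antisymm ?_ ?_⟩, ?_, ?_⟩
  · exact (ae_map_iff measurable_subtype_coe.aemeasurable hR.measurableSet).2
      (ae_of_all _ fun p => p.2)
  · exact measure_le_of_integral_le fun g _ => hle g
  -- The bound applied to `-g` gives the reverse inequality, so the second marginal is exactly `μY`.
  · refine measure_le_of_integral_le fun g _ => ?_
    have h := hle (-g)
    simp only [ContinuousMap.neg_apply, integral_neg] at h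
    linarith
  -- For `f ≥ 0` the cost is `c ∫ f`, and that of `-f` is `-c⁻¹ ∫ f`; these give the two bounds on
  -- the first marginal.
  · refine measure_le_of_integral_le fun f hf => ?_
    rw [hfst, hsmul, ← integral_const_mul]
    have h := hL (f.comp ⟨fun p : R => p.1.1, by fun_prop⟩) f 0 fun p => by simp
    have h2 : ∫ x, max (c * f x) (c⁻¹ * f x) ∂μX = ∫ x, c * f x ∂μX := by
      congr 1
      funext x
      exact max_eq_left (mul_le_mul_of_nonneg_right hcc (hf x))
    simpa [h2] using h
  · refine measure_le_of_integral_le fun f hf => ?_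
    rw [hsmul, hfst]
    have h := hL (-f.comp ⟨fun p : R => p.1.1, by fun_prop⟩) (-f) 0 fun p => by simp
    have h2 : ∫ x, max (c * (-f) x) (c⁻¹ * (-f) x) ∂μX = -(c⁻¹ * ∫ x, f x ∂μX) := by
      rw [← integral_const_mul, ← integral_neg]
      congr 1
      funext x
      have h3 : (-f) x ≤ 0 := neg_nonpos.2 (hf x)
      rw [max_eq_right (mul_le_mul_of_nonpos_right hcc h3)]
      simp
    rw [h2, map_neg] at h
    rw [← inv_mul_le_iff₀ hc0]
    simpa using h

/-- Points of two isometrically embedded spaces at distance at most `ε`. -/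
def nearRel {Z : Type*} [PseudoMetricSpace Z] (i : X → Z) (j : Y → Z) (ε : ℝ) : Set (X × Y) :=
  {p | dist (i p.1) (j p.2) ≤ ε}

omit [CompactSpace X] [MeasurableSpace X] [BorelSpace X] [CompactSpace Y] [MeasurableSpace Y]
  [BorelSpace Y] in
lemma abs_dist_sub_dist_le_of_mem_nearRel {Z : Type*} [PseudoMetricSpace Z] {i : X → Z} {j : Y → Z}
    (hi : Isometry i) (hj : Isometry j) {ε : ℝ} {p q : X × Y} (hp : p ∈ nearRel i j ε)
    (hq : q ∈ nearRel i j ε) : |dist p.1 q.1 - dist p.2 q.2| ≤ 2 * ε := by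
  rw [← hi.dist_eq, ← hj.dist_eq]
  have hp : dist (i p.1) (j p.2) ≤ ε := hp
  have hq : dist (i q.1) (j q.2) ≤ ε := hq
  have h1 := dist_triangle4 (i p.1) (j p.2) (j q.2) (i q.1)
  have h2 := dist_triangle4 (j p.2) (i p.1) (i q.1) (j q.2)
  rw [dist_comm (j q.2)] at h1
  rw [dist_comm (j p.2) (i p.1)] at h2
  rw [abs_le]
  constructor <;> linarith

omit [CompactSpace Y] [IsFiniteMeasure μX] [IsFiniteMeasure μY] in
-- The marriage condition. The image of `A` is compact, so every point of its closed
-- `ε`-neighbourhood is within `ε` of an actual point of the image. The image need not be closed in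
-- a semi-metric space, hence the passage to the closure, which has the same neighbourhood.
lemma measure_le_of_relativelyClose {Z : Type*} [PseudoMetricSpace Z] [MeasurableSpace Z]
    [BorelSpace Z] {i : X → Z} {j : Y → Z} (hi : Isometry i) (hj : Isometry j) {ε δ : ℝ}
    (hε : 0 ≤ ε) (h : RelativelyClose (μX.map i) (μY.map j) ε δ) {A : Set X} (hA : IsClosed A) :
    μX A ≤ ENNReal.ofReal (Real.exp δ) * μY (Prod.snd '' (nearRel i j ε ∩ Prod.fst ⁻¹' A)) := by
  have hcpt : IsCompact (i '' A) := hA.isCompact.image hi.continuous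
  calc μX A ≤ μX.map i (closure (i '' A)) := by
        rw [Measure.map_apply hi.continuous.measurable isClosed_closure.measurableSet]
        exact measure_mono fun x hx => subset_closure (mem_image_of_mem i hx)
    _ ≤ _ := (h _ isClosed_closure.measurableSet).2
    _ ≤ _ := by
        gcongr
        rw [cthickening_closure,
          Measure.map_apply hj.continuous.measurable isClosed_cthickening.measurableSet]
        refine measure_mono fun y hy => ?_
        rw [mem_preimage, hcpt.cthickening_eq_biUnion_closedBall hε, mem_iUnion₂] at hy
        obtain ⟨_, ⟨x, hx, rfl⟩, hxy⟩ := hy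
        refine ⟨(x, y), ⟨?_, hx⟩, rfl⟩
        rwa [mem_closedBall, dist_comm] at hxy

lemma exists_coupling_of_relativelyClose {Z : Type*} [PseudoMetricSpace Z] [MeasurableSpace Z]
    [BorelSpace Z] {i : X → Z} {j : Y → Z} (hi : Isometry i) (hj : Isometry j) {ε δ : ℝ}
    (hε : 0 ≤ ε) (hδ : 0 ≤ δ) (h : RelativelyClose (μX.map i) (μY.map j) ε δ) :
    ∃ γ : Measure (X × Y), IsFiniteMeasure γ ∧ (∀ᵐ p ∂γ, p ∈ nearRel i j ε) ∧
      MeasurePreserving Prod.snd γ μY ∧ γ.map Prod.fst ≤ ENNReal.ofReal (Real.exp δ) • μX ∧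
      μX ≤ ENNReal.ofReal (Real.exp δ) • γ.map Prod.fst := by
  have h' : RelativelyClose (μY.map j) (μX.map i) ε δ := fun A hA => (h A hA).symm
  refine exists_coupling (isClosed_le ?_ continuous_const) (Real.one_le_exp hδ)
    (fun A hA => measure_le_of_relativelyClose hi hj hε h hA) fun A hA => ?_
  · exact (hi.continuous.comp continuous_fst).dist (hj.continuous.comp continuous_snd)
  · refine (measure_le_of_relativelyClose hj hi hε h' hA).trans ?_
    gcongr
    rintro _ ⟨⟨y, x⟩, ⟨hp, hy⟩, rfl⟩
    refine ⟨(x, y), ⟨?_, hy⟩, rfl⟩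
    have hp : dist (j y) (i x) ≤ ε := hp
    rwa [dist_comm] at hp

variable (μX μY) in
/-- A coupling of `μY` with a measure comparable to `μX` that is supported on pairs between which
distances are distorted by at most `2ε`. -/
def HasCoupling (ε δ : ℝ) : Prop :=
  ∃ (R : Set (X × Y)) (γ : Measure (X × Y)),
    (∀ p ∈ R, ∀ q ∈ R, |dist p.1 q.1 - dist p.2 q.2| ≤ 2 * ε) ∧
    IsFiniteMeasure γ ∧ (∀ᵐ p ∂γ, p ∈ R) ∧ MeasurePreserving Prod.snd γ μY ∧
    γ.map Prod.fst ≤ ENNReal.ofReal (Real.exp δ) • μX ∧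
    μX ≤ ENNReal.ofReal (Real.exp δ) • γ.map Prod.fst

/-- Close spaces admit couplings in both directions. -/
theorem hasCoupling_of_areClose {ε δ : ℝ} (hε : 0 ≤ ε) (hδ : 0 ≤ δ) (h : AreClose μX μY ε δ) :
    HasCoupling μX μY ε δ ∧ HasCoupling μY μX ε δ := by
  obtain ⟨d, hdX, hdY, h⟩ := h
  have main : ∀ {Z : Type _} [PseudoMetricSpace Z] [MeasurableSpace Z] [BorelSpace Z] {i : X → Z}
      {j : Y → Z}, (∀ x x', dist (i x) (i x') = dist x x') →
      (∀ y y', dist (j y) (j y') = dist y y') → RelativelyClose (μX.map i) (μY.map j) ε δ →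
      HasCoupling μX μY ε δ ∧ HasCoupling μY μX ε δ := by
    intro Z _ _ _ i j hi hj h
    have hi : Isometry i := Isometry.of_dist_eq hi
    have hj : Isometry j := Isometry.of_dist_eq hj
    obtain ⟨γ, h1⟩ := exists_coupling_of_relativelyClose hi hj hε hδ h
    obtain ⟨γ', h2⟩ := exists_coupling_of_relativelyClose hj hi hε hδ fun A hA => (h A hA).symm
    exact ⟨⟨nearRel i j ε, γ, fun p hp q hq => abs_dist_sub_dist_le_of_mem_nearRel hi hj hp hq, h1⟩,
      ⟨nearRel j i ε, γ', fun p hp q hq => abs_dist_sub_dist_le_of_mem_nearRel hj hi hp hq, h2⟩⟩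
  -- `X ⊕ Y` has a default topology and `σ`-algebra, so those of `d` are passed explicitly.
  exact @main (X ⊕ Y) d (@borel (X ⊕ Y) d.toUniformSpace.toTopologicalSpace)
    (@BorelSpace.mk (X ⊕ Y) d.toUniformSpace.toTopologicalSpace
      (@borel (X ⊕ Y) d.toUniformSpace.toTopologicalSpace) rfl)
    Sum.inl Sum.inr hdX hdY h

end Coupling

noncomputable section

/-! ### Dirichlet forms over symmetric sets of pairs. -/

section DirichletForm

variable {Z : Type*} [MeasurableSpace Z] (γ : Measure Z)

/-- Twice the Dirichlet form of a function, for the pairs in `S`. -/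
def dirichletLIntegral (S : Set (Z × Z)) (w : Z → ℝ) : ℝ≥0∞ :=
  ∫⁻ x, ∫⁻ y in {y | (x, y) ∈ S}, ENNReal.ofReal ((w x - w y) ^ 2) ∂γ ∂γ

lemma setLIntegral_section_eq {S : Set (Z × Z)} (hS : MeasurableSet S) (F : Z → Z → ℝ≥0∞) (x : Z) :
    ∫⁻ y in {y | (x, y) ∈ S}, F x y ∂γ =
      ∫⁻ y, S.indicator (fun p => F p.1 p.2) (x, y) ∂γ :=
  (lintegral_indicator (measurable_prodMk_left hS) _).symm

variable [IsFiniteMeasure γ]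

/-- Expand the square; the two pure square terms agree because `S` is symmetric. -/
lemma integral_indicator_sub_sq {S : Set (Z × Z)} (hS : MeasurableSet S)
    (hsymm : ∀ x y, (x, y) ∈ S → (y, x) ∈ S) {w : Z → ℝ} (hw : MemLp w 2 γ) :
    Integrable (S.indicator fun p : Z × Z => (w p.1 - w p.2) ^ 2) (γ.prod γ) ∧
      ∫ p, S.indicator (fun p : Z × Z => (w p.1 - w p.2) ^ 2) p ∂(γ.prod γ) =
        2 * (∫ x, γ.real {y | (x, y) ∈ S} * w x ^ 2 ∂γ - ∫ x, kernelFun γ S w x * w x ∂γ) := by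
  have hw1 : Integrable w γ := hw.integrable one_le_two
  have hw2 : Integrable (fun x => w x ^ 2) γ := hw.integrable_sq
  have i1 : Integrable (S.indicator fun p : Z × Z => w p.1 ^ 2) (γ.prod γ) :=
    (hw2.comp_fst γ).indicator hS
  have i2 : Integrable (S.indicator fun p : Z × Z => w p.2 ^ 2) (γ.prod γ) :=
    (hw2.comp_snd γ).indicator hS
  have i3 : Integrable (S.indicator fun p : Z × Z => w p.1 * w p.2) (γ.prod γ) :=
    (hw1.mul_prod hw1).indicator hS
  have e : (S.indicator fun p : Z × Z => (w p.1 - w p.2) ^ 2) =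
      fun p => S.indicator (fun p : Z × Z => w p.1 ^ 2) p +
        S.indicator (fun p : Z × Z => w p.2 ^ 2) p -
        2 * S.indicator (fun p : Z × Z => w p.1 * w p.2) p := by
    funext p
    by_cases hp : p ∈ S
    · simp only [hp, indicator_of_mem]; ring
    · simp [hp]
  have e1 : ∫ p, S.indicator (fun p : Z × Z => w p.1 ^ 2) p ∂(γ.prod γ) =
      ∫ x, γ.real {y | (x, y) ∈ S} * w x ^ 2 ∂γ := by
    rw [integral_prod _ i1]
    congr 1
    funext x
    have : ∫ y, S.indicator (fun p : Z × Z => w p.1 ^ 2) (x, y) ∂γ =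
        ∫ y in {y | (x, y) ∈ S}, w x ^ 2 ∂γ :=
      integral_indicator (f := fun _ => w x ^ 2) (measurable_prodMk_left hS)
    rw [this, setIntegral_const, smul_eq_mul]
  have e2 : ∫ p, S.indicator (fun p : Z × Z => w p.2 ^ 2) p ∂(γ.prod γ) =
      ∫ p, S.indicator (fun p : Z × Z => w p.1 ^ 2) p ∂(γ.prod γ) := by
    rw [← integral_prod_swap]
    congr 1
    funext p
    by_cases hp : p ∈ S
    · have : p.swap ∈ S := hsymm _ _ hp
      simp [hp, this]
    · have : p.swap ∉ S := fun h => hp (hsymm _ _ h)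
      simp [hp, this]
  have e3 : ∫ p, S.indicator (fun p : Z × Z => w p.1 * w p.2) p ∂(γ.prod γ) =
      ∫ x, kernelFun γ S w x * w x ∂γ := by
    rw [integral_prod _ i3]
    congr 1
    funext x
    rw [kernelFun, mul_comm, ← integral_const_mul]
    exact integral_indicator (f := fun y => w x * w y) (measurable_prodMk_left hS)
  rw [e]
  refine ⟨(i1.add i2).sub (i3.const_mul 2), ?_⟩
  have h1 := integral_sub (i1.add i2) (i3.const_mul 2)
  simp only [Pi.add_apply] at h1
  rw [integral_const_mul, integral_add i1 i2, e2, e1, e3] at h1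
  rw [h1]
  ring

lemma integral_kernelFun_mul_le {S : Set (Z × Z)} (hS : MeasurableSet S)
    (hsymm : ∀ x y, (x, y) ∈ S → (y, x) ∈ S) {w : Z → ℝ} (hw : MemLp w 2 γ) :
    ∫ x, kernelFun γ S w x * w x ∂γ ≤ ∫ x, γ.real {y | (x, y) ∈ S} * w x ^ 2 ∂γ := by
  have h : 0 ≤ ∫ p, S.indicator (fun p : Z × Z => (w p.1 - w p.2) ^ 2) p ∂(γ.prod γ) :=
    integral_nonneg fun p => indicator_nonneg (fun _ _ => sq_nonneg _) _
  rw [(integral_indicator_sub_sq γ hS hsymm hw).2] at h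
  linarith

/-- The Dirichlet form is the difference of the weighted norm and the averaging form. -/
lemma dirichletLIntegral_eq {S : Set (Z × Z)} (hS : MeasurableSet S)
    (hsymm : ∀ x y, (x, y) ∈ S → (y, x) ∈ S) {w : Z → ℝ} (hwm : Measurable w) (hw : MemLp w 2 γ) :
    dirichletLIntegral γ S w = ENNReal.ofReal
      (2 * (∫ x, γ.real {y | (x, y) ∈ S} * w x ^ 2 ∂γ - ∫ x, kernelFun γ S w x * w x ∂γ)) := by
  have hmeas : Measurable (S.indicator fun p : Z × Z => ENNReal.ofReal ((w p.1 - w p.2) ^ 2)) :=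
    Measurable.indicator (by fun_prop) hS
  obtain ⟨hi, he⟩ := integral_indicator_sub_sq γ hS hsymm hw
  rw [← he, ofReal_integral_eq_lintegral_ofReal hi (ae_of_all _ fun p =>
    indicator_nonneg (fun _ _ => sq_nonneg _) _)]
  calc dirichletLIntegral γ S w
      = ∫⁻ x, ∫⁻ y, S.indicator (fun p => ENNReal.ofReal ((w p.1 - w p.2) ^ 2)) (x, y) ∂γ ∂γ :=
        lintegral_congr fun x =>
          setLIntegral_section_eq γ hS (fun x y => ENNReal.ofReal ((w x - w y) ^ 2)) x
    _ = _ := by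
        rw [← lintegral_prod _ hmeas.aemeasurable]
        refine lintegral_congr fun p => ?_
        by_cases hp : p ∈ S <;> simp [hp]

end DirichletForm

/-! ### Changing the radius in the Dirichlet form. -/

section Enlarge

variable {X : Type*} [PseudoMetricSpace X] [CompactSpace X] [MeasurableSpace X] [BorelSpace X]
  {μ : Measure X} [IsFiniteMeasure μ] {Λ ρ η : ℝ}

omit [CompactSpace X] [BorelSpace X] [IsFiniteMeasure μ] in
lemma measure_ball_ne_zero (hρ : 0 < ρ) {x : X} (hx : x ∈ μ.support) : μ (ball x ρ) ≠ 0 :=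
  ((Measure.mem_support_iff_forall x).1 hx _ (ball_mem_nhds x hρ)).ne'

omit [CompactSpace X] [BorelSpace X] in
lemma SLV.measure_diff_le (h : SLV μ Λ ρ η) (hρ : 0 < ρ) {x : X}
    (hx : x ∈ μ.support) :
    μ (ball x (ρ + η) \ ball x ρ) ≤ ENNReal.ofReal (Λ * (η / ρ)) * μ (ball x ρ) := by
  have h0 := measure_ball_ne_zero hρ hx
  have hpos : 0 < μ.real (ball x ρ) := ENNReal.toReal_pos h0 (measure_ne_top _ _)
  have h1 := (div_le_iff₀ hpos).1 (h x hx)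
  rw [← ENNReal.ofReal_toReal (measure_ne_top μ (ball x (ρ + η) \ ball x ρ)),
    ← ENNReal.ofReal_toReal (measure_ne_top μ (ball x ρ)),
    ← ENNReal.ofReal_mul' ENNReal.toReal_nonneg]
  exact ENNReal.ofReal_le_ofReal h1

omit [CompactSpace X] [BorelSpace X] in
lemma SLV.measure_ball_add_le (h : SLV μ Λ ρ η) (hΛ : 0 < Λ) (hρ : 0 < ρ) (hη : 0 ≤ η) {x : X}
    (hx : x ∈ μ.support) :
    μ (ball x (ρ + η)) ≤ ENNReal.ofReal (1 + Λ * (η / ρ)) * μ (ball x ρ) := by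
  have hsub : ball x ρ ⊆ ball x (ρ + η) := ball_subset_ball (by linarith)
  rw [ENNReal.ofReal_add zero_le_one (by positivity), ENNReal.ofReal_one, add_mul, one_mul]
  calc μ (ball x (ρ + η)) = μ (ball x ρ ∪ ball x (ρ + η) \ ball x ρ) := by
        rw [union_sdiff_cancel hsub]
    _ ≤ _ := (measure_union_le _ _).trans (by gcongr; exact h.measure_diff_le hρ hx)

omit [CompactSpace X] [BorelSpace X] in
lemma BIV.measure_ball_le (h : BIV μ Λ ρ η) (hΛ : 0 < Λ) (hη : 0 ≤ η) {x y : X}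
    (hx : x ∈ μ.support) (hy : y ∈ μ.support) (hxy : dist x y ≤ ρ + η) :
    μ (ball x ρ) ≤ ENNReal.ofReal Λ * μ (ball x ρ ∩ ball y ρ) := by
  have h1 := (inv_mul_le_iff₀ hΛ).1 (h x hx y hy hxy)
  have h2 : μ.real (ball x ρ) ≤ μ.real (ball x (ρ + η)) :=
    measureReal_mono (ball_subset_ball (by linarith))
  rw [← ENNReal.ofReal_toReal (measure_ne_top μ (ball x ρ)),
    ← ENNReal.ofReal_toReal (measure_ne_top μ (ball x ρ ∩ ball y ρ)), ← ENNReal.ofReal_mul hΛ.le]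
  exact ENNReal.ofReal_le_ofReal (h2.trans h1)

/-- The average of the squared differences of `w` over the ball around a point. -/
def localEnergy (μ : Measure X) (ρ : ℝ) (w : X → ℝ) (x : X) : ℝ≥0∞ :=
  (∫⁻ y in ball x ρ, ENNReal.ofReal ((w x - w y) ^ 2) ∂μ) / μ (ball x ρ)

lemma inv_le_mul_inv_of_le_mul {a b c : ℝ≥0∞} (hc0 : c ≠ 0) (hc : c ≠ ∞) (h : a ≤ c * b) :
    b⁻¹ ≤ c * a⁻¹ := by
  calc b⁻¹ = c * (c * b)⁻¹ := by
        rw [ENNReal.mul_inv (Or.inl hc0) (Or.inl hc), ← mul_assoc, ENNReal.mul_inv_cancel hc0 hc,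
          one_mul]
    _ ≤ c * a⁻¹ := by gcongr

omit [CompactSpace X] [BorelSpace X] in
-- Average `(w x - w y)² ≤ 2(w x - w z)² + 2(w y - w z)²` over `z` in the intersection `U` of the
-- two balls. Since `U` fills at least the fraction `Λ⁻¹` of either ball, averages over `U` cost at
-- most a factor `Λ` against those over the balls.
lemma BIV.ofReal_sq_sub_le (h : BIV μ Λ ρ η) (hΛ : 0 < Λ) (hρ : 0 < ρ) (hη : 0 ≤ η)
    {w : X → ℝ} (hw : Measurable w) {x y : X} (hx : x ∈ μ.support) (hy : y ∈ μ.support)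
    (hxy : dist x y ≤ ρ + η) :
    ENNReal.ofReal ((w x - w y) ^ 2) ≤
      ENNReal.ofReal (2 * Λ) * (localEnergy μ ρ w x + localEnergy μ ρ w y) := by
  set U := ball x ρ ∩ ball y ρ
  have hΛ0 : ENNReal.ofReal Λ ≠ 0 := (ENNReal.ofReal_pos.2 hΛ).ne'
  have hxU : μ (ball x ρ) ≤ ENNReal.ofReal Λ * μ U := h.measure_ball_le hΛ hη hx hy hxy
  have hyU : μ (ball y ρ) ≤ ENNReal.ofReal Λ * μ U := by
    have := h.measure_ball_le hΛ hη hy hx (by rwa [dist_comm])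
    rwa [inter_comm] at this
  have hU0 : μ U ≠ 0 := fun h0 => measure_ball_ne_zero hρ hx (by
    rw [h0, mul_zero] at hxU
    exact le_antisymm hxU zero_le)
  have hmul : μ U * ENNReal.ofReal ((w x - w y) ^ 2) ≤
      2 * (∫⁻ z in ball x ρ, ENNReal.ofReal ((w x - w z) ^ 2) ∂μ +
        ∫⁻ z in ball y ρ, ENNReal.ofReal ((w y - w z) ^ 2) ∂μ) := by
    calc μ U * ENNReal.ofReal ((w x - w y) ^ 2)
        = ∫⁻ _ in U, ENNReal.ofReal ((w x - w y) ^ 2) ∂μ := by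
          rw [setLIntegral_const, mul_comm]
      _ ≤ ∫⁻ z in U, 2 * (ENNReal.ofReal ((w x - w z) ^ 2) +
            ENNReal.ofReal ((w y - w z) ^ 2)) ∂μ := by
          refine lintegral_mono fun z => ?_
          have h2 : (2 : ℝ≥0∞) = ENNReal.ofReal 2 := by simp
          rw [h2, ← ENNReal.ofReal_add (sq_nonneg _) (sq_nonneg _),
            ← ENNReal.ofReal_mul (by norm_num)]
          refine ENNReal.ofReal_le_ofReal ?_
          nlinarith [sq_nonneg ((w x - w z) + (w y - w z))]
      _ = 2 * (∫⁻ z in U, ENNReal.ofReal ((w x - w z) ^ 2) ∂μ +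
            ∫⁻ z in U, ENNReal.ofReal ((w y - w z) ^ 2) ∂μ) := by
          rw [lintegral_const_mul _ (by fun_prop), lintegral_add_left (by fun_prop)]
      _ ≤ _ := by
          gcongr
          · exact inter_subset_left
          · exact inter_subset_right
  calc ENNReal.ofReal ((w x - w y) ^ 2)
      = (μ U)⁻¹ * (μ U * ENNReal.ofReal ((w x - w y) ^ 2)) := by
        rw [← mul_assoc, ENNReal.inv_mul_cancel hU0 (measure_ne_top _ _), one_mul]
    _ ≤ (μ U)⁻¹ * (2 * (∫⁻ z in ball x ρ, ENNReal.ofReal ((w x - w z) ^ 2) ∂μ +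
        ∫⁻ z in ball y ρ, ENNReal.ofReal ((w y - w z) ^ 2) ∂μ)) := by gcongr
    _ = 2 * ((∫⁻ z in ball x ρ, ENNReal.ofReal ((w x - w z) ^ 2) ∂μ) * (μ U)⁻¹ +
        (∫⁻ z in ball y ρ, ENNReal.ofReal ((w y - w z) ^ 2) ∂μ) * (μ U)⁻¹) := by ring
    _ ≤ 2 * ((∫⁻ z in ball x ρ, ENNReal.ofReal ((w x - w z) ^ 2) ∂μ) *
          (ENNReal.ofReal Λ * (μ (ball x ρ))⁻¹) +
        (∫⁻ z in ball y ρ, ENNReal.ofReal ((w y - w z) ^ 2) ∂μ) *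
          (ENNReal.ofReal Λ * (μ (ball y ρ))⁻¹)) := by
        gcongr
        · exact inv_le_mul_inv_of_le_mul hΛ0 ENNReal.ofReal_ne_top hxU
        · exact inv_le_mul_inv_of_le_mul hΛ0 ENNReal.ofReal_ne_top hyU
    _ = _ := by
        rw [ENNReal.ofReal_mul (by norm_num), localEnergy, localEnergy, div_eq_mul_inv,
          div_eq_mul_inv]
        simp only [ENNReal.ofReal_ofNat]
        ring

lemma measurable_lintegral_ball {w : X → ℝ} (hw : Measurable w) :
    Measurable fun x => ∫⁻ y in ball x ρ, ENNReal.ofReal ((w x - w y) ^ 2) ∂μ := by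
  have hS := measurableSet_dist_lt X ρ
  have : (fun x => ∫⁻ y in ball x ρ, ENNReal.ofReal ((w x - w y) ^ 2) ∂μ) = fun x =>
      ∫⁻ y, {p : X × X | dist p.2 p.1 < ρ}.indicator
        (fun p => ENNReal.ofReal ((w p.1 - w p.2) ^ 2)) (x, y) ∂μ :=
    funext fun x => setLIntegral_section_eq μ hS (fun x y => ENNReal.ofReal ((w x - w y) ^ 2)) x
  rw [this]
  exact Measurable.lintegral_prod_right' (Measurable.indicator (by fun_prop) hS)

/-- Under the spherical layer and ball intersection conditions, enlarging the radius increases the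
Dirichlet form by a controlled factor only. -/
theorem dirichletLIntegral_enlarge (hSLV : SLV μ Λ ρ η) (hBIV : BIV μ Λ ρ η) (hΛ : 0 < Λ)
    (hρ : 0 < ρ) (hη : 0 ≤ η) {w : X → ℝ} (hw : Measurable w) :
    dirichletLIntegral μ {p | dist p.2 p.1 < ρ + η} w ≤
      ENNReal.ofReal (1 + 4 * Λ ^ 2 * (η / ρ)) *
        dirichletLIntegral μ {p | dist p.2 p.1 < ρ} w := by
  set T : Set (X × X) := {p | ρ ≤ dist p.2 p.1 ∧ dist p.2 p.1 < ρ + η}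
  have hT : MeasurableSet T :=
    (isClosed_le continuous_const (continuous_snd.dist continuous_fst)).measurableSet.inter
      (measurableSet_dist_lt X (ρ + η))
  have hTx : ∀ x, {y | (x, y) ∈ T} = ball x (ρ + η) \ ball x ρ := fun x => by
    ext y
    simp only [T, mem_ofPred_eq, mem_sdiff, mem_ball, not_lt]
    exact and_comm
  have hTsymm : ∀ x y, (x, y) ∈ T ↔ (y, x) ∈ T := fun x y => by simp [T, dist_comm]
  set F : X → X → ℝ≥0∞ := fun x y => ENNReal.ofReal ((w x - w y) ^ 2)
  have hhm : Measurable fun x => ∫⁻ y in ball x ρ, F x y ∂μ := measurable_lintegral_ball hw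
  have hmb : Measurable fun x => μ (ball x ρ) :=
    measurable_measure_prodMk_left (ν := μ) (measurableSet_dist_lt X ρ)
  have hH : Measurable (localEnergy μ ρ w) := hhm.div hmb
  have hD : dirichletLIntegral μ {p | dist p.2 p.1 < ρ} w = ∫⁻ x, ∫⁻ y in ball x ρ, F x y ∂μ ∂μ := rfl
  have hsplit : dirichletLIntegral μ {p | dist p.2 p.1 < ρ + η} w =
      dirichletLIntegral μ {p | dist p.2 p.1 < ρ} w + dirichletLIntegral μ T w := by
    rw [hD]
    unfold dirichletLIntegral
    rw [← lintegral_add_left hhm]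
    refine lintegral_congr fun x => ?_
    rw [hTx, ← lintegral_union (measurableSet_ball.diff measurableSet_ball) disjoint_sdiff_right,
      union_sdiff_cancel (ball_subset_ball (by linarith))]
    rfl
  -- The layer at `x` has at most `Λ η / ρ` times the volume of the ball, and this volume cancels
  -- the denominator of `localEnergy`.
  have hlayer : ∫⁻ x, μ {y | (x, y) ∈ T} * localEnergy μ ρ w x ∂μ ≤
      ENNReal.ofReal (Λ * (η / ρ)) * dirichletLIntegral μ {p | dist p.2 p.1 < ρ} w := by
    rw [hD, ← lintegral_const_mul' _ _ ENNReal.ofReal_ne_top]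
    refine lintegral_mono_ae ?_
    filter_upwards [Measure.support_mem_ae (μ := μ)] with x hx
    rw [hTx]
    refine (mul_le_mul_left (hSLV.measure_diff_le hρ hx) _).trans ?_
    rw [mul_assoc, localEnergy, ENNReal.mul_div_cancel (measure_ball_ne_zero hρ hx)
      (measure_ne_top _ _)]
  -- Integrate the pointwise estimate over the added pairs `T`; by symmetry of `T` the contributions
  -- of both endpoints agree, whence the constant `4Λ² = 2Λ · 2 · Λ`.
  have hT1 : dirichletLIntegral μ T w ≤
      ENNReal.ofReal (2 * Λ) * (∫⁻ x, μ {y | (x, y) ∈ T} * localEnergy μ ρ w x ∂μ +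
        ∫⁻ x, μ {y | (x, y) ∈ T} * localEnergy μ ρ w x ∂μ) := by
    have hswap : ∫⁻ x, ∫⁻ y in {y | (x, y) ∈ T}, localEnergy μ ρ w y ∂μ ∂μ =
        ∫⁻ x, μ {y | (x, y) ∈ T} * localEnergy μ ρ w x ∂μ := by
      have h1 : ∀ x, ∫⁻ y in {y | (x, y) ∈ T}, localEnergy μ ρ w y ∂μ =
          ∫⁻ y, T.indicator (fun p => localEnergy μ ρ w p.2) (x, y) ∂μ := fun x =>
        setLIntegral_section_eq μ hT (fun _ y => localEnergy μ ρ w y) x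
      simp only [h1]
      rw [lintegral_lintegral_swap]
      · refine lintegral_congr fun y => ?_
        rw [mul_comm, ← setLIntegral_const]
        refine (lintegral_congr fun x => ?_).trans
          (lintegral_indicator (measurable_prodMk_left hT) _)
        by_cases hxy : (x, y) ∈ T
        · have : x ∈ Prod.mk y ⁻¹' T := (hTsymm x y).1 hxy
          rw [indicator_of_mem hxy, indicator_of_mem this]
        · have : x ∉ Prod.mk y ⁻¹' T := fun h => hxy ((hTsymm x y).2 h)
          rw [indicator_of_notMem hxy, indicator_of_notMem this]
      · exact (Measurable.indicator (hH.comp measurable_snd) hT).aemeasurable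
    have hμT : Measurable fun x => μ {y | (x, y) ∈ T} := measurable_measure_prodMk_left hT
    nth_rw 2 [← hswap]
    rw [← lintegral_add_left (by exact hμT.mul hH), ← lintegral_const_mul' _ _ ENNReal.ofReal_ne_top]
    refine lintegral_mono_ae ?_
    filter_upwards [Measure.support_mem_ae (μ := μ)] with x hx
    calc ∫⁻ y in {y | (x, y) ∈ T}, F x y ∂μ
        ≤ ∫⁻ y in {y | (x, y) ∈ T}, ENNReal.ofReal (2 * Λ) *
            (localEnergy μ ρ w x + localEnergy μ ρ w y) ∂μ := by
          refine setLIntegral_mono_ae (by fun_prop) ?_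
          filter_upwards [Measure.support_mem_ae (μ := μ)] with y hy hyT
          refine hBIV.ofReal_sq_sub_le hΛ hρ hη hw hx hy ?_
          rw [dist_comm]
          exact hyT.2.le
      _ = _ := by
          rw [lintegral_const_mul _ (by fun_prop), lintegral_add_left (by fun_prop),
            setLIntegral_const, mul_comm (localEnergy μ ρ w x)]
  calc dirichletLIntegral μ {p | dist p.2 p.1 < ρ + η} w
      = dirichletLIntegral μ {p | dist p.2 p.1 < ρ} w + dirichletLIntegral μ T w := hsplit
    _ ≤ dirichletLIntegral μ {p | dist p.2 p.1 < ρ} w + ENNReal.ofReal (2 * Λ) *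
        (ENNReal.ofReal (Λ * (η / ρ)) * dirichletLIntegral μ {p | dist p.2 p.1 < ρ} w +
        ENNReal.ofReal (Λ * (η / ρ)) * dirichletLIntegral μ {p | dist p.2 p.1 < ρ} w) := by
        gcongr
        refine hT1.trans ?_
        gcongr
    _ = _ := by
        have h4 : 1 + 4 * Λ ^ 2 * (η / ρ) = 1 + 2 * Λ * (2 * (Λ * (η / ρ))) := by ring
        rw [h4, ENNReal.ofReal_add zero_le_one (by positivity), ENNReal.ofReal_one,
          ENNReal.ofReal_mul (p := 2 * Λ) (by positivity),
          ENNReal.ofReal_mul (p := 2) (q := Λ * (η / ρ)) (by positivity)]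
        simp only [ENNReal.ofReal_ofNat]
        ring

end Enlarge

/-! ### Averaging over the fibres of a measure preserving map. -/

section Projection

variable {Z Y : Type*} [MeasurableSpace Z] [MeasurableSpace Y] {γ : Measure Z} {μ : Measure Y}
  [IsFiniteMeasure γ] [IsFiniteMeasure μ] {f : Z → Y}

/-- The adjoint of the pullback of functions along a measure preserving map, that is, the
conditional expectation as a function on the target. -/
def fiberMean (hf : MeasurePreserving f γ μ) : Lp ℝ 2 γ →L[ℝ] Lp ℝ 2 μ :=
  (Lp.compMeasurePreservingₗᵢ ℝ f hf).toContinuousLinearMap.adjoint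

omit [IsFiniteMeasure γ] [IsFiniteMeasure μ] in
lemma inner_fiberMean_left (hf : MeasurePreserving f γ μ) (w : Lp ℝ 2 γ) (g : Lp ℝ 2 μ) :
    inner ℝ g (fiberMean hf w) = inner ℝ (Lp.compMeasurePreserving f hf g) w :=
  ContinuousLinearMap.adjoint_inner_right _ _ _

omit [IsFiniteMeasure γ] in
lemma setIntegral_fiberMean (hf : MeasurePreserving f γ μ) (w : Lp ℝ 2 γ) {s : Set Y}
    (hs : MeasurableSet s) : ∫ y in s, fiberMean hf w y ∂μ = ∫ z in f ⁻¹' s, w z ∂γ := by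
  rw [← L2.inner_indicatorConstLp_one (𝕜 := ℝ) hs (measure_ne_top μ s), inner_fiberMean_left,
    Lp.indicatorConstLp_compMeasurePreserving, L2.inner_indicatorConstLp_one]

omit [IsFiniteMeasure γ] in
-- A kernel pulled back from `Y` sees `w` only through its fibre means, and its output is again
-- pulled back from `Y`. Pairing that output with `w` thus involves the fibre means only.
lemma integral_kernelFun_preimage_mul (hf : MeasurePreserving f γ μ) (w : Lp ℝ 2 γ)
    {S : Set (Y × Y)} (hS : MeasurableSet S) :
    ∫ z, kernelFun γ (Prod.map f f ⁻¹' S) w z * w z ∂γ =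
      ∫ y, kernelFun μ S (fiberMean hf w) y * fiberMean hf w y ∂μ := by
  have h1 : ∫ y, kernelFun μ S (fiberMean hf w) y * fiberMean hf w y ∂μ =
      inner ℝ (kernelOp μ hS (fiberMean hf w)) (fiberMean hf w) := by
    rw [L2.inner_def]
    refine integral_congr_ae ?_
    filter_upwards [kernelOp_coeFn μ hS (fiberMean hf w)] with y hy
    rw [hy]
    simp only [RCLike.inner_apply, conj_trivial]
    exact mul_comm _ _
  rw [h1, inner_fiberMean_left, L2.inner_def]
  refine integral_congr_ae ?_
  filter_upwards [Lp.coeFn_compMeasurePreserving (kernelOp μ hS (fiberMean hf w)) hf,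
    hf.quasiMeasurePreserving.ae (kernelOp_coeFn μ hS (fiberMean hf w))] with z h2 h3
  rw [h2, Function.comp_apply, h3]
  simp only [RCLike.inner_apply, conj_trivial]
  have h4 : kernelFun μ S (fiberMean hf w) (f z) = kernelFun γ (Prod.map f f ⁻¹' S) w z :=
    setIntegral_fiberMean hf w (measurable_prodMk_left hS)
  rw [h4, mul_comm]

omit [IsFiniteMeasure γ] [IsFiniteMeasure μ] in
-- Conditional Jensen. For the fibre mean `v`, adjointness gives `∫ m v² = ∫ m(f) v(f) w`, and `v(f)
-- w` is at most half the sum of the squares.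
lemma integral_mul_fiberMean_sq_le (hf : MeasurePreserving f γ μ) (w : Lp ℝ 2 γ) {m : Y → ℝ}
    (hm : MemLp m ∞ μ) (hm0 : 0 ≤ m) :
    ∫ y, m y * fiberMean hf w y ^ 2 ∂μ ≤ ∫ z, m (f z) * w z ^ 2 ∂γ := by
  set v := fiberMean hf w
  have hv2 : Integrable (fun y => m y * v y ^ 2) μ :=
    (Lp.memLp v).integrable_sq.mul_of_top_right hm
  have hmf : MemLp (fun z => m (f z)) ∞ γ := hm.comp_measurePreserving hf
  have hw2 : Integrable (fun z => m (f z) * w z ^ 2) γ :=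
    (Lp.memLp w).integrable_sq.mul_of_top_right hmf
  have hv2f : Integrable (fun z => m (f z) * v (f z) ^ 2) γ :=
    hf.integrable_comp_of_integrable hv2
  have h1 : ∫ y, m y * v y ^ 2 ∂μ = inner ℝ (mulOp μ hm v) v := by
    rw [L2.inner_def]
    refine integral_congr_ae ?_
    filter_upwards [mulOp_coeFn μ hm v] with y hy
    rw [hy]
    simp only [RCLike.inner_apply, conj_trivial]
    ring
  have h2 : inner ℝ (mulOp μ hm v) v ≤
      ∫ z, (1 / 2 : ℝ) * (m (f z) * v (f z) ^ 2) + (1 / 2) * (m (f z) * w z ^ 2) ∂γ := by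
    rw [inner_fiberMean_left, L2.inner_def]
    refine integral_mono_ae (L2.integrable_inner _ _)
      ((hv2f.const_mul _).add (hw2.const_mul _)) ?_
    filter_upwards [Lp.coeFn_compMeasurePreserving (mulOp μ hm v) hf,
      hf.quasiMeasurePreserving.ae (mulOp_coeFn μ hm v)] with z h2 h3
    rw [h2, Function.comp_apply, h3]
    simp only [RCLike.inner_apply, conj_trivial]
    nlinarith [mul_nonneg (hm0 (f z)) (sq_nonneg (v (f z) - w z))]
  have h3 : ∫ z, m (f z) * v (f z) ^ 2 ∂γ = ∫ y, m y * v y ^ 2 ∂μ := by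
    have h := integral_map (μ := γ) hf.measurable.aemeasurable
      (f := fun y => m y * v y ^ 2) (by rw [hf.map_eq]; exact hv2.aestronglyMeasurable)
    rw [hf.map_eq] at h
    exact h.symm
  rw [integral_add (hv2f.const_mul _) (hw2.const_mul _), integral_const_mul, integral_const_mul,
    h3, ← h1] at h2
  linarith

end Projection

/-! ### Pullback of functions to the coupling. -/

section Pullback

variable {Z X : Type*} [MeasurableSpace Z] [MeasurableSpace X] {γ : Measure Z} {μ : Measure X}
  {f : Z → X} {c : ℝ≥0∞}

lemma memLp_comp_of_map_le (hf : Measurable f) (hc : c ≠ ∞) (h : γ.map f ≤ c • μ) (u : Lp ℝ 2 μ) :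
    MemLp (fun z => u (f z)) 2 γ :=
  MemLp.comp_of_map ((Lp.memLp u).of_measure_le_smul hc h) hf.aemeasurable

lemma ae_comp_of_map_le (hf : Measurable f) (h : γ.map f ≤ c • μ) {p : X → Prop}
    (hp : ∀ᵐ x ∂μ, p x) : ∀ᵐ z ∂γ, p (f z) :=
  ae_of_ae_map hf.aemeasurable
    ((Measure.absolutelyContinuous_of_le_smul h).ae_le hp)

/-- Pullback of functions along a map for which the image measure is dominated. -/
def pullback (hf : Measurable f) (hc : c ≠ ∞) (h : γ.map f ≤ c • μ) : Lp ℝ 2 μ →ₗ[ℝ] Lp ℝ 2 γ where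
  toFun u := (memLp_comp_of_map_le hf hc h u).toLp
  map_add' u v := by
    rw [← MemLp.toLp_add, MemLp.toLp_eq_toLp_iff]
    exact ae_comp_of_map_le hf h (Lp.coeFn_add u v)
  map_smul' a u := by
    rw [RingHom.id_apply, ← MemLp.toLp_const_smul, MemLp.toLp_eq_toLp_iff]
    exact ae_comp_of_map_le hf h (Lp.coeFn_smul a u)

lemma pullback_coeFn (hf : Measurable f) (hc : c ≠ ∞) (h : γ.map f ≤ c • μ) (u : Lp ℝ 2 μ) :
    pullback hf hc h u =ᵐ[γ] fun z => u (f z) :=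
  (memLp_comp_of_map_le hf hc h u).coeFn_toLp

lemma ofReal_integral_toReal_mul_sq [IsFiniteMeasure γ] {m : Z → ℝ≥0∞} (hm : Measurable m) {M : ℝ≥0∞}
    (hM : M ≠ ∞) (hmM : ∀ z, m z ≤ M) {w : Z → ℝ} (hw : MemLp w 2 γ) :
    ENNReal.ofReal (∫ z, (m z).toReal * w z ^ 2 ∂γ) = ∫⁻ z, m z * ENNReal.ofReal (w z ^ 2) ∂γ := by
  have hmb : MemLp (fun z => (m z).toReal) ∞ γ :=
    memLp_top_of_bound hm.ennreal_toReal.aestronglyMeasurable M.toReal (ae_of_all _ fun z => by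
      rw [Real.norm_of_nonneg ENNReal.toReal_nonneg]
      exact ENNReal.toReal_mono hM (hmM z))
  have hi : Integrable (fun z => (m z).toReal * w z ^ 2) γ := hw.integrable_sq.mul_of_top_right hmb
  rw [ofReal_integral_eq_lintegral_ofReal hi
    (ae_of_all _ fun z => by positivity)]
  refine lintegral_congr fun z => ?_
  rw [ENNReal.ofReal_mul ENNReal.toReal_nonneg,
    ENNReal.ofReal_toReal (ne_top_of_le_ne_top hM (hmM z))]

end Pullback

/-! ### Transfer of Rayleigh quotients along a coupling. -/

section Transfer

variable {X Y : Type*} [MetricSpace X] [CompactSpace X] [MeasurableSpace X] [BorelSpace X]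
  [MetricSpace Y] [CompactSpace Y] [MeasurableSpace Y] [BorelSpace Y]
  {μX : Measure X} [IsFiniteMeasure μX] {μY : Measure Y} [IsFiniteMeasure μY]
  {R : Set (X × Y)} {γ : Measure (X × Y)} [IsFiniteMeasure γ] {Λ ρ ε δ : ℝ}

omit [CompactSpace Y] [BorelSpace Y] [IsFiniteMeasure γ] in
/-- Transfer of the Dirichlet form along a coupling. -/
lemma dirichletLIntegral_coupling_le
    (hR : ∀ p ∈ R, ∀ q ∈ R, |dist p.1 q.1 - dist p.2 q.2| ≤ 2 * ε) (hγR : ∀ᵐ p ∂γ, p ∈ R)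
    (hle : γ.map Prod.fst ≤ ENNReal.ofReal (Real.exp δ) • μX) {u : X → ℝ} (hu : Measurable u) :
    dirichletLIntegral γ (Prod.map Prod.snd Prod.snd ⁻¹' {p | dist p.2 p.1 < ρ})
        (fun p => u p.1) ≤
      ENNReal.ofReal (Real.exp (2 * δ)) *
        dirichletLIntegral μX {p | dist p.2 p.1 < ρ + 2 * ε} u := by
  set c := ENNReal.ofReal (Real.exp δ)
  have hcc : ENNReal.ofReal (Real.exp (2 * δ)) = c * c := by
    rw [← ENNReal.ofReal_mul (Real.exp_nonneg δ), ← Real.exp_add, two_mul]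
  have hmeas := measurable_lintegral_ball (μ := μX) (ρ := ρ + 2 * ε) hu
  -- If `q.2` is within `ρ` of `p.2`, then `q.1` is within `ρ + 2ε` of `p.1`. Each of the two
  -- integrations against the first marginal costs a factor `e^δ`.
  have hinner : ∀ p ∈ R, ∫⁻ q in {q | (p, q) ∈ Prod.map Prod.snd Prod.snd ⁻¹'
      {p : Y × Y | dist p.2 p.1 < ρ}}, ENNReal.ofReal ((u p.1 - u q.1) ^ 2) ∂γ ≤
      c * ∫⁻ x in ball p.1 (ρ + 2 * ε), ENNReal.ofReal ((u p.1 - u x) ^ 2) ∂μX := by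
    intro p hp
    calc _ ≤ ∫⁻ q in Prod.fst ⁻¹' ball p.1 (ρ + 2 * ε),
          ENNReal.ofReal ((u p.1 - u q.1) ^ 2) ∂γ := by
          refine lintegral_mono_set' ?_
          filter_upwards [hγR] with q hq hqS
          have h1 : dist q.2 p.2 < ρ := hqS
          have h2 := (abs_le.1 (hR q hq p hp)).2
          change dist q.1 p.1 < ρ + 2 * ε
          linarith
      _ = ∫⁻ x in ball p.1 (ρ + 2 * ε), ENNReal.ofReal ((u p.1 - u x) ^ 2) ∂(γ.map Prod.fst) :=
          (setLIntegral_map (f := fun x => ENNReal.ofReal ((u p.1 - u x) ^ 2)) measurableSet_ball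
            (by fun_prop) measurable_fst).symm
      _ ≤ ∫⁻ x in ball p.1 (ρ + 2 * ε), ENNReal.ofReal ((u p.1 - u x) ^ 2) ∂(c • μX) :=
          lintegral_mono' (Measure.restrict_mono subset_rfl hle) le_rfl
      _ = _ := by rw [Measure.restrict_smul, lintegral_smul_measure, smul_eq_mul]
  calc _ ≤ ∫⁻ p, c * ∫⁻ x in ball p.1 (ρ + 2 * ε), ENNReal.ofReal ((u p.1 - u x) ^ 2) ∂μX ∂γ := by
        refine lintegral_mono_ae ?_
        filter_upwards [hγR] with p hp using hinner p hp
    _ = ∫⁻ x, c * ∫⁻ x' in ball x (ρ + 2 * ε), ENNReal.ofReal ((u x - u x') ^ 2) ∂μX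
          ∂(γ.map Prod.fst) := (lintegral_map (hmeas.const_mul c) measurable_fst).symm
    _ ≤ ∫⁻ x, c * ∫⁻ x' in ball x (ρ + 2 * ε), ENNReal.ofReal ((u x - u x') ^ 2) ∂μX ∂(c • μX) :=
        lintegral_mono' hle le_rfl
    _ = c * (c * dirichletLIntegral μX {p | dist p.2 p.1 < ρ + 2 * ε} u) := by
        rw [lintegral_smul_measure, smul_eq_mul, lintegral_const_mul _ hmeas]
        rfl
    _ = _ := by rw [hcc, mul_assoc]

omit [CompactSpace X] [CompactSpace Y] [IsFiniteMeasure μX] [IsFiniteMeasure μY]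
  [IsFiniteMeasure γ] in
/-- Transfer of the volume of balls along a coupling. -/
lemma measure_ball_coupling_le
    (hR : ∀ p ∈ R, ∀ q ∈ R, |dist p.1 q.1 - dist p.2 q.2| ≤ 2 * ε) (hγR : ∀ᵐ p ∂γ, p ∈ R)
    (hsnd : MeasurePreserving Prod.snd γ μY)
    (hge : μX ≤ ENNReal.ofReal (Real.exp δ) • γ.map Prod.fst) {p : X × Y} (hp : p ∈ R) :
    μX (ball p.1 ρ) ≤ ENNReal.ofReal (Real.exp δ) * μY (ball p.2 (ρ + 2 * ε)) := by
  refine (hge _).trans ?_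
  rw [Measure.smul_apply, smul_eq_mul, Measure.map_apply measurable_fst measurableSet_ball,
    ← hsnd.measure_preimage measurableSet_ball.nullMeasurableSet]
  gcongr 1
  refine measure_mono_ae ?_
  filter_upwards [hγR] with q hq hqS
  have h1 : dist q.1 p.1 < ρ := hqS
  have h2 := (abs_le.1 (hR q hq p hp)).1
  change dist q.2 p.2 < ρ + 2 * ε
  linarith

/-- Transfer of the weighted norm along a coupling. -/
lemma weightForm_le_coupling
    (hR : ∀ p ∈ R, ∀ q ∈ R, |dist p.1 q.1 - dist p.2 q.2| ≤ 2 * ε) (hγR : ∀ᵐ p ∂γ, p ∈ R)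
    (hsnd : MeasurePreserving Prod.snd γ μY)
    (hle : γ.map Prod.fst ≤ ENNReal.ofReal (Real.exp δ) • μX)
    (hge : μX ≤ ENNReal.ofReal (Real.exp δ) • γ.map Prod.fst) (hΛ : 0 < Λ) (hρ : 0 < ρ)
    (hε : 0 ≤ ε) (hSLV : SLV μY Λ ρ (2 * ε)) (u : Lp ℝ 2 μX) :
    weightForm μX ρ u ≤ Real.exp (2 * δ) * (1 + Λ * (2 * ε / ρ)) *
      ∫ p, μY.real (ball p.2 ρ) * u p.1 ^ 2 ∂γ := by
  set c := ENNReal.ofReal (Real.exp δ)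
  set a := ENNReal.ofReal (1 + Λ * (2 * ε / ρ))
  have hum : Measurable u := (Lp.stronglyMeasurable u).measurable
  have hmX : Measurable fun x => μX (ball x ρ) :=
    measurable_measure_prodMk_left (ν := μX) (measurableSet_dist_lt X ρ)
  have hmY : Measurable fun y => μY (ball y ρ) :=
    measurable_measure_prodMk_left (ν := μY) (measurableSet_dist_lt Y ρ)
  have hw : MemLp (fun p : X × Y => u p.1) 2 γ :=
    memLp_comp_of_map_le measurable_fst ENNReal.ofReal_ne_top hle u
  have hI : 0 ≤ ∫ p, μY.real (ball p.2 ρ) * u p.1 ^ 2 ∂γ :=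
    integral_nonneg fun p => mul_nonneg measureReal_nonneg (sq_nonneg _)
  have hccaReal : ENNReal.ofReal (Real.exp (2 * δ) * (1 + Λ * (2 * ε / ρ))) = c * (c * a) := by
    rw [ENNReal.ofReal_mul (Real.exp_nonneg _), two_mul, Real.exp_add,
      ENNReal.ofReal_mul (Real.exp_nonneg _), mul_assoc]
  rw [← ENNReal.ofReal_le_ofReal_iff (by positivity), ENNReal.ofReal_mul (by positivity), hccaReal]
  have e1 : ENNReal.ofReal (weightForm μX ρ u) =
      ∫⁻ x, μX (ball x ρ) * ENNReal.ofReal (u x ^ 2) ∂μX :=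
    ofReal_integral_toReal_mul_sq hmX (measure_ne_top μX univ)
      (fun x => measure_mono (subset_univ _)) (Lp.memLp u)
  have e2 : ENNReal.ofReal (∫ p, μY.real (ball p.2 ρ) * u p.1 ^ 2 ∂γ) =
      ∫⁻ p, μY (ball p.2 ρ) * ENNReal.ofReal (u p.1 ^ 2) ∂γ :=
    ofReal_integral_toReal_mul_sq (m := fun p : X × Y => μY (ball p.2 ρ))
      (hmY.comp measurable_snd) (measure_ne_top μY univ)
      (fun x => measure_mono (subset_univ _)) hw
  rw [e1, e2]
  -- One factor `e^δ` comes from replacing `μX` by the first marginal, the other from comparing ball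
  -- volumes; the layer condition on `Y` brings the radius `ρ + 2ε` back to `ρ`.
  calc ∫⁻ x, μX (ball x ρ) * ENNReal.ofReal (u x ^ 2) ∂μX
      ≤ ∫⁻ x, μX (ball x ρ) * ENNReal.ofReal (u x ^ 2) ∂(c • γ.map Prod.fst) :=
        lintegral_mono' hge le_rfl
    _ = c * ∫⁻ p, μX (ball p.1 ρ) * ENNReal.ofReal (u p.1 ^ 2) ∂γ := by
        rw [lintegral_smul_measure, smul_eq_mul, 
          lintegral_map (f := fun x => μX (ball x ρ) * ENNReal.ofReal (u x ^ 2))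
            (hmX.mul (hum.pow_const 2).ennreal_ofReal) measurable_fst]
    _ ≤ c * ∫⁻ p, (c * a) * (μY (ball p.2 ρ) * ENNReal.ofReal (u p.1 ^ 2)) ∂γ := by
        gcongr 1
        refine lintegral_mono_ae ?_
        filter_upwards [hγR, hsnd.quasiMeasurePreserving.ae (Measure.support_mem_ae (μ := μY))]
          with p hp hpY
        rw [← mul_assoc]
        gcongr 1
        refine (measure_ball_coupling_le hR hγR hsnd hge hp).trans ?_
        rw [mul_assoc]
        gcongr 1
        exact hSLV.measure_ball_add_le hΛ hρ (by positivity) hpY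
    _ = _ := by
        rw [lintegral_const_mul' _ _
          (ENNReal.mul_ne_top ENNReal.ofReal_ne_top ENNReal.ofReal_ne_top), ← mul_assoc]

lemma weightForm_pos (hρ : 0 < ρ) {u : Lp ℝ 2 μX} (hu : u ≠ 0) : 0 < weightForm μX ρ u := by
  rw [← norm_sq_sqrtWeightEquiv μX hρ]
  have : sqrtWeightEquiv μX hρ u ≠ 0 := by simpa using hu
  positivity

lemma dirichletLIntegral_dist_lt_eq (u : Lp ℝ 2 μX) :
    dirichletLIntegral μX {p | dist p.2 p.1 < ρ} u =
      ENNReal.ofReal (2 * (weightForm μX ρ u - avgForm μX ρ u)) :=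
  dirichletLIntegral_eq μX (measurableSet_dist_lt X ρ) (fun x y h => by
    change dist x y < ρ
    rw [dist_comm]
    exact h) (Lp.stronglyMeasurable u).measurable (Lp.memLp u)

lemma avgForm_le_weightForm (u : Lp ℝ 2 μX) : avgForm μX ρ u ≤ weightForm μX ρ u :=
  integral_kernelFun_mul_le μX (measurableSet_dist_lt X ρ) (fun x y h => by
    change dist x y < ρ
    rw [dist_comm]
    exact h) (Lp.memLp u)

variable (hsnd : MeasurePreserving Prod.snd γ μY)
  (hle : γ.map Prod.fst ≤ ENNReal.ofReal (Real.exp δ) • μX)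

/-- The transfer map from `L²(X)` to `L²(Y)` along a coupling. -/
def transfer : Lp ℝ 2 μX →ₗ[ℝ] Lp ℝ 2 μY :=
  (fiberMean hsnd).toLinearMap ∘ₗ pullback measurable_fst ENNReal.ofReal_ne_top hle

omit [MetricSpace X] [CompactSpace X] [BorelSpace X] [IsFiniteMeasure μX] [IsFiniteMeasure γ] in
lemma weightForm_transfer_le (u : Lp ℝ 2 μX) :
    weightForm μY ρ (transfer hsnd hle u) ≤ ∫ p, μY.real (ball p.2 ρ) * u p.1 ^ 2 ∂γ := by
  have hm : MemLp (fun y => μY.real (ball y ρ)) ∞ μY :=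
    memLp_top_of_bound (measurable_measureReal_ball μY ρ).aestronglyMeasurable (μY.real univ)
      (ae_of_all _ fun y => by
        rw [Real.norm_of_nonneg measureReal_nonneg]
        exact measureReal_mono (subset_univ _))
  refine (integral_mul_fiberMean_sq_le hsnd
    (pullback measurable_fst ENNReal.ofReal_ne_top hle u) hm fun y => measureReal_nonneg).trans_eq ?_
  refine integral_congr_ae ?_
  filter_upwards [pullback_coeFn measurable_fst ENNReal.ofReal_ne_top hle u] with p hp
  rw [hp]

omit [MetricSpace X] [CompactSpace X] [BorelSpace X] [IsFiniteMeasure μX] [IsFiniteMeasure γ] in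
lemma avgForm_transfer (u : Lp ℝ 2 μX) :
    avgForm μY ρ (transfer hsnd hle u) =
      ∫ p, kernelFun γ (Prod.map Prod.snd Prod.snd ⁻¹' {p | dist p.2 p.1 < ρ}) (fun p => u p.1) p *
        u p.1 ∂γ := by
  have h := pullback_coeFn measurable_fst ENNReal.ofReal_ne_top hle u
  rw [← kernelFun_congr γ _ h]
  refine (integral_kernelFun_preimage_mul hsnd
    (pullback measurable_fst ENNReal.ofReal_ne_top hle u) (measurableSet_dist_lt Y ρ)).symm.trans ?_
  refine integral_congr_ae ?_
  filter_upwards [h] with p hp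
  rw [hp]

/-- The left side is the Dirichlet form of the pulled back function on `X × Y`: its averaging form
survives the fibre averaging unchanged, and its norm is still the one upstairs. -/
lemma weight_sub_avgForm_transfer_le
    (hR : ∀ p ∈ R, ∀ q ∈ R, |dist p.1 q.1 - dist p.2 q.2| ≤ 2 * ε) (hγR : ∀ᵐ p ∂γ, p ∈ R)
    (hΛ : 0 < Λ) (hρ : 0 < ρ) (hε : 0 ≤ ε) (hSLV : SLV μX Λ ρ (2 * ε)) (hBIV : BIV μX Λ ρ (2 * ε))
    (u : Lp ℝ 2 μX) :
    ∫ p, μY.real (ball p.2 ρ) * u p.1 ^ 2 ∂γ - avgForm μY ρ (transfer hsnd hle u) ≤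
      Real.exp (2 * δ) * (1 + 4 * Λ ^ 2 * (2 * ε / ρ)) * (weightForm μX ρ u - avgForm μX ρ u) := by
  have hum : Measurable u := (Lp.stronglyMeasurable u).measurable
  have hw : MemLp (fun p : X × Y => u p.1) 2 γ :=
    memLp_comp_of_map_le measurable_fst ENNReal.ofReal_ne_top hle u
  have h1 := dirichletLIntegral_coupling_le (ρ := ρ) hR hγR hle hum
  have h2 := dirichletLIntegral_enlarge hSLV hBIV hΛ hρ (by positivity) hum
  have hsymm : ∀ p q : X × Y, (p, q) ∈ Prod.map Prod.snd Prod.snd ⁻¹' {p : Y × Y | dist p.2 p.1 < ρ} →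
      (q, p) ∈ Prod.map Prod.snd Prod.snd ⁻¹' {p : Y × Y | dist p.2 p.1 < ρ} := fun p q h => by
    change dist p.2 q.2 < ρ
    rw [dist_comm]
    exact h
  rw [dirichletLIntegral_dist_lt_eq (ρ := ρ)] at h2
  rw [dirichletLIntegral_eq γ (w := fun p : X × Y => u p.1)
    ((measurable_snd.prodMap measurable_snd) (measurableSet_dist_lt Y ρ)) hsymm (hum.comp measurable_fst) hw, ← avgForm_transfer hsnd hle] at h1
  have h3 := h1.trans (mul_le_mul_right h2 _)
  have h0 := avgForm_le_weightForm (ρ := ρ) u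
  have hball : ∀ p : X × Y, γ.real {q | (p, q) ∈ Prod.map Prod.snd Prod.snd ⁻¹'
      {p : Y × Y | dist p.2 p.1 < ρ}} = μY.real (ball p.2 ρ) := fun p =>
    hsnd.measureReal_preimage measurableSet_ball.nullMeasurableSet
  simp only [hball] at h3
  rw [← ENNReal.ofReal_mul (by positivity), ← ENNReal.ofReal_mul (by positivity),
    ENNReal.ofReal_le_ofReal_iff (mul_nonneg (by positivity)
      (mul_nonneg (by positivity) (by linarith)))] at h3
  linarith

/-- Along a coupling, an upper bound of the Rayleigh quotient on a `k`-dimensional subspace is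
transferred with controlled loss. -/
theorem exists_submodule_transfer (hc : HasCoupling μX μY ε δ) (hΛ : 0 < Λ) (hρ : 0 < ρ)
    (hε : 0 ≤ ε) (hSLV : SLV μX Λ ρ (2 * ε)) (hBIV : BIV μX Λ ρ (2 * ε))
    (hSLV' : SLV μY Λ ρ (2 * ε)) {a s : ℝ} (hs : 0 ≤ s)
    (ha : Real.exp (4 * δ) * ((1 + Λ * (2 * ε / ρ)) * (1 + 4 * Λ ^ 2 * (2 * ε / ρ))) ≤ a)
    (has : a * s * ρ ^ 2 < 1) {k : ℕ}
    {V : Submodule ℝ (Lp ℝ 2 μX)} (hV : Module.finrank ℝ V = k)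
    (hVf : ∀ u ∈ V, (1 - s * ρ ^ 2) * weightForm μX ρ u ≤ avgForm μX ρ u) :
    ∃ W : Submodule ℝ (Lp ℝ 2 μY), Module.finrank ℝ W = k ∧
      ∀ v ∈ W, (1 - a * s * ρ ^ 2) * weightForm μY ρ v ≤ avgForm μY ρ v := by
  obtain ⟨R, γ, hR, hγ, hγR, hsnd, hle, hge⟩ := hc
  -- The estimate is kept with the norm upstairs, because this norm also bounds that of `u` and so
  -- yields injectivity.
  have key : ∀ u ∈ V, (1 - a * s * ρ ^ 2) * ∫ p, μY.real (ball p.2 ρ) * u p.1 ^ 2 ∂γ ≤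
      avgForm μY ρ (transfer hsnd hle u) := fun u hu => by
    have h1 := weight_sub_avgForm_transfer_le hsnd hle hR hγR hΛ hρ hε hSLV hBIV u
    have h2 := weightForm_le_coupling hR hγR hsnd hle hge hΛ hρ hε hSLV' u
    set N := ∫ p, μY.real (ball p.2 ρ) * u p.1 ^ 2 ∂γ
    have hN : 0 ≤ N := integral_nonneg fun p => mul_nonneg measureReal_nonneg (sq_nonneg _)
    have h3 : weightForm μX ρ u - avgForm μX ρ u ≤ s * ρ ^ 2 * weightForm μX ρ u := by
      linarith [hVf u hu]
    have h4 : N - avgForm μY ρ (transfer hsnd hle u) ≤ a * (s * ρ ^ 2 * N) :=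
      calc _ ≤ _ := h1
        _ ≤ Real.exp (2 * δ) * (1 + 4 * Λ ^ 2 * (2 * ε / ρ)) * (s * ρ ^ 2 *
              (Real.exp (2 * δ) * (1 + Λ * (2 * ε / ρ)) * N)) := by
            gcongr
            exact h3.trans (by gcongr)
        _ = Real.exp (4 * δ) * ((1 + Λ * (2 * ε / ρ)) * (1 + 4 * Λ ^ 2 * (2 * ε / ρ))) *
              (s * ρ ^ 2 * N) := by
            rw [show 4 * δ = 2 * δ + 2 * δ by ring, Real.exp_add]
            ring
        _ ≤ _ := by gcongr
    linarith
  -- If the transfer of `u` vanishes, so does its averaging form. As `1 - a s ρ² > 0`, the norm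
  -- upstairs is then zero, and hence `u = 0`.
  have hinj : Function.Injective ((transfer hsnd hle).comp V.subtype) := by
    rw [injective_iff_map_eq_zero]
    rintro ⟨u, hu⟩ h
    have hu0 : transfer hsnd hle u = 0 := h
    by_contra hne
    have hpos := weightForm_pos hρ (fun h0 => hne (Subtype.ext h0) : u ≠ 0)
    have h1 := key u hu
    have h2 := weightForm_le_coupling hR hγR hsnd hle hge hΛ hρ hε hSLV' u
    have h3 : avgForm μY ρ (transfer hsnd hle u) = 0 := by
      rw [hu0]
      refine integral_eq_zero_of_ae ?_
      filter_upwards [Lp.coeFn_zero ℝ 2 μY] with y hy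
      rw [hy, Pi.zero_apply, mul_zero]
    rw [h3] at h1
    have h4 : ∫ p, μY.real (ball p.2 ρ) * u p.1 ^ 2 ∂γ ≤ 0 :=
      nonpos_of_mul_nonpos_right h1 (by linarith)
    have h5 : 0 ≤ Real.exp (2 * δ) * (1 + Λ * (2 * ε / ρ)) := by positivity
    linarith [mul_nonpos_of_nonneg_of_nonpos h5 h4]
  refine ⟨LinearMap.range ((transfer hsnd hle).comp V.subtype), ?_, ?_⟩
  · rw [LinearMap.finrank_range_of_inj hinj, hV]
  · rintro _ ⟨⟨u, hu⟩, rfl⟩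
    -- Fibre averaging decreases the norm, which helps since its coefficient `1 - a s ρ²` is
    -- positive.
    refine le_trans ?_ (key u hu)
    exact mul_le_mul_of_nonneg_left (weightForm_transfer_le hsnd hle u) (by linarith)

end Transfer

end

/-! ### Comparison of the eigenvalues and passage to the limit. -/

section Comparison

variable {X Y : Type*} [MetricSpace X] [CompactSpace X] [MeasurableSpace X] [BorelSpace X]
  [MetricSpace Y] [CompactSpace Y] [MeasurableSpace Y] [BorelSpace Y]
  {μX : Measure X} [IsFiniteMeasure μX] {μY : Measure Y} [IsFiniteMeasure μY] {Λ ρ ε δ : ℝ}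

/-- A nonzero `u` in `V` exists as `k ≥ 1`, and its averaging form is at most its positive weighted
norm. -/
lemma nonneg_of_weightForm_le (hρ : 0 < ρ) {k : ℕ} (hk : 1 ≤ k) {s : ℝ}
    {V : Submodule ℝ (Lp ℝ 2 μX)} (hV : Module.finrank ℝ V = k)
    (hVf : ∀ u ∈ V, (1 - s * ρ ^ 2) * weightForm μX ρ u ≤ avgForm μX ρ u) : 0 ≤ s := by
  obtain ⟨u, hu, hu0⟩ := V.exists_mem_ne_zero_of_ne_bot (by
    rintro rfl
    rw [finrank_bot] at hV
    omega)
  have h1 := hVf u hu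
  have h2 := avgForm_le_weightForm (ρ := ρ) u
  have h3 := weightForm_pos hρ hu0
  by_contra! hs
  have : 0 < -s * ρ ^ 2 * weightForm μX ρ u := by
    have : 0 < -s := by linarith
    positivity
  linarith

lemma lambda_le_of_hasCoupling (hc : HasCoupling μX μY ε δ) (hΛ : 0 < Λ) (hρ : 0 < ρ)
    (hε : 0 ≤ ε) (hδ : 0 ≤ δ) (hSLV : SLV μX Λ ρ (2 * ε)) (hBIV : BIV μX Λ ρ (2 * ε))
    (hSLV' : SLV μY Λ ρ (2 * ε)) {a s : ℝ}
    (ha : Real.exp (4 * δ) * ((1 + Λ * (2 * ε / ρ)) * (1 + 4 * Λ ^ 2 * (2 * ε / ρ))) ≤ a)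
    (has : a * s * ρ ^ 2 < 1) {k : ℕ} (hk : 1 ≤ k) (hlt : lambda μX ρ k < s) :
    lambda μY ρ k ≤ ((a * s : ℝ) : EReal) := by
  have ha1 : 1 ≤ a := by
    refine le_trans ?_ ha
    have h1 : 1 ≤ Real.exp (4 * δ) := Real.one_le_exp (by positivity)
    have h2 : 1 ≤ 1 + Λ * (2 * ε / ρ) := le_add_of_nonneg_right (by positivity)
    have h3 : 1 ≤ 1 + 4 * Λ ^ 2 * (2 * ε / ρ) := le_add_of_nonneg_right (by positivity)
    exact one_le_mul_of_one_le_of_one_le h1 (one_le_mul_of_one_le_of_one_le h2 h3)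
  have hs : s ≤ (ρ ^ 2)⁻¹ := by
    rw [← one_div, le_div_iff₀ (by positivity)]
    rcases le_or_gt s 0 with h | h
    · exact (mul_nonpos_of_nonpos_of_nonneg h (by positivity)).trans zero_le_one
    · refine le_trans ?_ has.le
      rw [mul_assoc]
      exact le_mul_of_one_le_left (by positivity) ha1
  obtain ⟨V, hV, hVf⟩ := exists_submodule_of_lambda_lt μX hρ hs hlt
  have hs0 := nonneg_of_weightForm_le hρ hk hV hVf
  obtain ⟨W, hW, hWf⟩ := exists_submodule_transfer hc hΛ hρ hε hSLV hBIV hSLV' hs0 ha has hV hVf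
  refine lambda_le_of_submodule μY hρ hk ?_ hW hWf
  rwa [← one_div, lt_div_iff₀ (by positivity)]

end Comparison

/-- Origin of `C`: the quadratic term `16 Λ³ x²` is at most `4 Λ³ x` for `x ≤ 1/4`. -/
lemma mul_le_one_add_mul {Λ x : ℝ} (hΛ : 0 < Λ) (hx : 0 ≤ x) (hx4 : x ≤ 1 / 4) :
    (1 + Λ * (2 * x)) * (1 + 4 * Λ ^ 2 * (2 * x)) ≤
      1 + (2 * Λ + 8 * Λ ^ 2 + 4 * Λ ^ 3) * x := by
  have : 0 ≤ Λ ^ 3 * x * (1 / 4 - x) := mul_nonneg (by positivity) (by linarith)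
  nlinarith

/-- Let `s` decrease to `l`; the assumption `l < A⁻¹ t` keeps such `s` admissible. -/
lemma inv_mul_le_of_forall {A t : ℝ} (hA : 0 < A) {l m : EReal} (hlt : l < ((A⁻¹ * t : ℝ) : EReal))
    (h : ∀ s : ℝ, A * s < t → l < s → m ≤ ((A * s : ℝ) : EReal)) : ((A⁻¹ : ℝ) : EReal) * m ≤ l := by
  refine le_of_forall_gt_imp_ge_of_dense fun b hb => ?_
  obtain ⟨s, hls, hs⟩ := EReal.lt_iff_exists_real_btwn.1 (lt_min hb hlt)
  have hst : s < A⁻¹ * t := EReal.coe_lt_coe_iff.1 (hs.trans_le (min_le_right _ _))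
  have h1 : A * s < t := by
    rwa [← div_eq_inv_mul, lt_div_iff₀' hA] at hst
  refine le_trans ?_ (hs.le.trans (min_le_left _ _))
  calc ((A⁻¹ : ℝ) : EReal) * m ≤ ((A⁻¹ : ℝ) : EReal) * ((A * s : ℝ) : EReal) :=
        mul_le_mul_of_nonneg_left (h s h1 hls) (EReal.coe_nonneg.2 (inv_nonneg.2 hA.le))
    _ = s := by rw [← EReal.coe_mul, inv_mul_cancel_left₀ hA.ne']

/-- Here nothing is assumed about the size of `m`. If `A m < l`, then `s = A⁻¹ r` with `r` between
the two is admissible because `r < l < t`, and it gives the contradiction `l ≤ r`. -/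
lemma le_mul_of_forall {A t : ℝ} (hA : 0 < A) {l m : EReal} (hlt : l < (t : EReal))
    (h : ∀ s : ℝ, A * s < t → m < s → l ≤ ((A * s : ℝ) : EReal)) : l ≤ (A : EReal) * m := by
  refine le_of_forall_gt_imp_ge_of_dense fun b hb => ?_
  by_contra! hbl
  obtain ⟨r, hbr, hrl⟩ := EReal.lt_iff_exists_real_btwn.1 hbl
  have hm : m < ((A⁻¹ * r : ℝ) : EReal) := by
    by_contra! hle
    have h1 := mul_le_mul_of_nonneg_left hle (EReal.coe_nonneg.2 hA.le)
    rw [← EReal.coe_mul, mul_inv_cancel_left₀ hA.ne'] at h1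
    exact absurd (h1.trans_lt hb) (not_lt.2 hbr.le)
  have h2 := h (A⁻¹ * r) (by
    rw [mul_inv_cancel_left₀ hA.ne']
    exact EReal.coe_lt_coe_iff.1 (hrl.trans hlt)) hm
  rw [mul_inv_cancel_left₀ hA.ne'] at h2
  exact absurd hrl (not_lt.2 h2)

end MMSpace

theorem theorem5p8 (Λ : ℝ) (hΛ : 0 < Λ) :
    ∃ C : ℝ, 0 < C ∧
      ∀ (X : Type u) [MetricSpace X] [CompactSpace X] [MeasurableSpace X] [BorelSpace X]
        (Y : Type v) [MetricSpace Y] [CompactSpace Y] [MeasurableSpace Y] [BorelSpace Y]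
        (μX : Measure X) [IsFiniteMeasure μX] (μY : Measure Y) [IsFiniteMeasure μY]
        (ρ ε δ : ℝ), 0 < ρ → 0 ≤ ε → ε ≤ ρ / 4 → 0 ≤ δ →
        MMSpace.AreClose μX μY ε δ →
        MMSpace.SLV μX Λ ρ (2 * ε) → MMSpace.BIV μX Λ ρ (2 * ε) →
        MMSpace.SLV μY Λ ρ (2 * ε) → MMSpace.BIV μY Λ ρ (2 * ε) →
        ∀ k : ℕ, 1 ≤ k →
          MMSpace.lambda μX ρ k <
            ((Real.exp (-4 * δ) * (1 + C * ε / ρ)⁻¹ * (ρ ^ 2)⁻¹ : ℝ) : EReal) →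
          ((Real.exp (-4 * δ) * (1 + C * ε / ρ)⁻¹ : ℝ) : EReal) * MMSpace.lambda μY ρ k ≤
              MMSpace.lambda μX ρ k ∧
            MMSpace.lambda μX ρ k ≤
              ((Real.exp (4 * δ) * (1 + C * ε / ρ) : ℝ) : EReal) * MMSpace.lambda μY ρ k := by
  refine ⟨2 * Λ + 8 * Λ ^ 2 + 4 * Λ ^ 3, by positivity, ?_⟩
  intro X _ _ _ _ Y _ _ _ _ μX _ μY _ ρ ε δ hρ hε hερ hδ hclose hX hX' hY hY' k hk hlt
  obtain ⟨hXY, hYX⟩ := MMSpace.hasCoupling_of_areClose hε hδ hclose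
  set C := 2 * Λ + 8 * Λ ^ 2 + 4 * Λ ^ 3
  have hC : 0 < C := by positivity
  have hB : 1 ≤ 1 + C * ε / ρ := le_add_of_nonneg_right (by positivity)
  have hexp : 1 ≤ Real.exp (4 * δ) := Real.one_le_exp (by positivity)
  set A := Real.exp (4 * δ) * (1 + C * ε / ρ) with hAdef
  have hA1 : 1 ≤ A := one_le_mul_of_one_le_of_one_le hexp hB
  have hA : 0 < A := by linarith
  have hAinv : Real.exp (-4 * δ) * (1 + C * ε / ρ)⁻¹ = A⁻¹ := by
    rw [hAdef, mul_inv, ← Real.exp_neg, neg_mul]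
  have haA : Real.exp (4 * δ) * ((1 + Λ * (2 * ε / ρ)) * (1 + 4 * Λ ^ 2 * (2 * ε / ρ))) ≤ A := by
    have h := MMSpace.mul_le_one_add_mul hΛ (x := ε / ρ) (by positivity)
      ((div_le_iff₀ hρ).2 (by linarith))
    rw [hAdef, mul_div_assoc 2, mul_div_assoc C]
    gcongr
  have hs : ∀ s : ℝ, A * s < (ρ ^ 2)⁻¹ → A * s * ρ ^ 2 < 1 := fun s h => by
    rwa [← one_div, lt_div_iff₀ (by positivity)] at h
  rw [hAinv] at hlt ⊢
  -- The second inequality only needs `λ_k(X, ρ) < ρ⁻²`; the full hypothesis serves the first.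
  have hlt' : MMSpace.lambda μX ρ k < (((ρ ^ 2)⁻¹ : ℝ) : EReal) := by
    refine hlt.trans_le (EReal.coe_le_coe_iff.2 ?_)
    exact mul_le_of_le_one_left (by positivity) (inv_le_one_of_one_le₀ hA1)
  exact ⟨MMSpace.inv_mul_le_of_forall hA hlt fun s h1 h2 =>
      MMSpace.lambda_le_of_hasCoupling hXY hΛ hρ hε hδ hX hX' hY haA (hs s h1) hk h2,
    MMSpace.le_mul_of_forall hA hlt' fun s h1 h2 =>
      MMSpace.lambda_le_of_hasCoupling hYX hΛ hρ hε hδ hY hY' hX haA (hs s h1) hk h2⟩
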